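/- Let $k\ge 0$ be an integer and $h,\Delta t>0$. Consider the fully discrete $P^k$ local discontinuous Galerkin (LDG) scheme for $u_{tt}=u_{xx}$ on the uniform mesh of cells $I_j=((j-\tfrac12)h,(j+\tfrac12)h)$, $j\in\mathbb Z$: with $q=u_x$, alternating fluxes $\widetilde u=u^-$, $\widetilde q=q^+$, the local monomial basis $\big(\tfrac{x-x_j}{h/2}\big)^l$, $0\le l\le k$, and central differences in time with step $\Delta t$, elimination of $q$ gives, for the coefficient vectors $\mathbf u_j^n$, $$M\,\frac{\mathbf u_j^{n+1}-2\mathbf u_j^n+\mathbf u_j^{n-1}}{\Delta t^2}+K_0\mathbf u_j^n+K_{-1}\mathbf u_{j-1}^n+K_{+1}\mathbf u_{j+1}^n=0 ,$$ with $M$ the local mass matrix. Let $\mathcal K(\xi)=K_0+K_{-1}e^{-i\xi h}+K_{+1}e^{i\xi h}$ for $\xi\in\Pi_h=[-\pi/h,\pi/h]$, and consider the generalized eigenvalue problem $\mathcal K(\xi)\mathbf v=\sigma M\mathbf v$, $\mathbf v\ne 0$. Assume the stability condition that $\sigma\le 4/\Delta t^2$ for all its eigenvalues $\sigma$ and all $\xi\in\Pi_h$.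 There exist real-analytic functions $\sigma_1,\dots,\sigma_{k+1}$ on $\Pi_h$ such that, for every $\xi\in\Pi_h$, $\sigma_1(\xi),\dots,\sigma_{k+1}(\xi)$ are the eigenvalues belonging to an $M$-orthonormal basis of eigenvectors, and one of these functions vanishes at $\xi=0$. Fix any such family, denote by $\sigma_{ph}$ a member with $\sigma_{ph}(0)=0$ (physical mode) and by $\sigma_{sp,1},\dots,\sigma_{sp,k}$ the remaining members (spurious modes), and put, for each mode $m$, $$\omega_m(\xi)=\operatorname{sign}(\xi)\,\frac{2}{\Delta t}\arcsin\Big(\frac{\sqrt{\sigma_m(\xi)}\,\Delta t}{2}\Big),\qquad v_g^m=\frac{d\omega_m}{d\xi}.$$ In each of the limits below the derivative exists at all points of $\Pi_h$ close enough to (and different from) the limit point, limits at $\pm\pi/h$ are taken from inside $\Pi_h$, and: 1. (Physical mode.) $\displaystyle\lim_{\xi\to0}v_g^{ph}(\xi)=1$, and $\displaystyle\lim_{\xi\to\pm\pi/h}v_g^{ph}(\xi)=1$ if $(k,\Delta t)=(0,h)$, while $\displaystyle\lim_{\xi\to\pm\pi/h}v_g^{ph}(\xi)=0$ otherwise. 2.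 (Spurious modes.) For each $i=1,\dots,k$ and each of the four limits $\xi\to0^+$, $\xi\to0^-$, $\xi\to\pi/h$, $\xi\to-\pi/h$: if $|\omega_{sp,i}(\xi)|$ does not tend to $\pi/\Delta t$ in that limit, then $v_g^{sp,i}(\xi)\to0$ in that limit. -/

import Mathlib

open Filter Topology Matrix

noncomputable section

namespace LDG

/-! The fully discrete `P^k`-LDG scheme for `u_tt = u_xx` on a uniform mesh of size `h`.
By translation invariance the reference cell is `(-h/2, h/2)`; the local coefficient vector of a
piecewise polynomial on the cell centred at `x_j` refers to the monomials `((x - x_j)/(h/2))^l`. -/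

/-- The local monomial basis function `(x / (h/2))^l` on the cell `(-h/2, h/2)`. -/
def basisFn (h : ℝ) (l : ℕ) (x : ℝ) : ℝ := (x / (h / 2)) ^ l

/-- The local mass matrix `M_{m,l} = ∫ φ_l φ_m`. -/
def massMatrix (k : ℕ) (h : ℝ) : Matrix (Fin (k + 1)) (Fin (k + 1)) ℝ :=
  Matrix.of fun m l => ∫ x in (-(h / 2))..(h / 2), basisFn h l x * basisFn h m x

/-- The local weak derivative `-∫ φ_l φ_m'`. -/
def volumeMatrix (k : ℕ) (h : ℝ) : Matrix (Fin (k + 1)) (Fin (k + 1)) ℝ :=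
  Matrix.of fun m l => -∫ x in (-(h / 2))..(h / 2), basisFn h l x * deriv (basisFn h m) x

/-! The equation for `q` with flux `ũ = u⁻`, tested with `v = φ_m` on the cell `I_j`,
`∫ q v = -∫ u v' + u⁻_{j+1/2} v⁻_{j+1/2} - u⁻_{j-1/2} v⁺_{j-1/2}`,
reads `M q_j = G₀ u_j + G₋₁ u_{j-1}`. -/

/-- `G₀`: contribution of `u_j` (volume term and trace of `u_j` at its right end). -/
def gradZero (k : ℕ) (h : ℝ) : Matrix (Fin (k + 1)) (Fin (k + 1)) ℝ :=
  volumeMatrix k h + Matrix.of fun m l : Fin (k + 1) => basisFn h l (h / 2) * basisFn h m (h / 2)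

/-- `G₋₁`: contribution of `u_{j-1}` (its right trace, seen at the left end of `I_j`). -/
def gradMinus (k : ℕ) (h : ℝ) : Matrix (Fin (k + 1)) (Fin (k + 1)) ℝ :=
  Matrix.of fun m l => -(basisFn h l (h / 2) * basisFn h m (-(h / 2)))

/-! The equation for `u_tt` with flux `q̃ = q⁺`, tested with `w = φ_m` on the cell `I_j`,
`∫ u_tt w = -∫ q w' + q⁺_{j+1/2} w⁻_{j+1/2} - q⁺_{j-1/2} w⁺_{j-1/2}`,
reads `M (u_tt)_j = H₀ q_j + H₊₁ q_{j+1}`. -/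

/-- `H₀`: contribution of `q_j` (volume term and trace of `q_j` at its left end). -/
def divZero (k : ℕ) (h : ℝ) : Matrix (Fin (k + 1)) (Fin (k + 1)) ℝ :=
  volumeMatrix k h - Matrix.of fun m l : Fin (k + 1) => basisFn h l (-(h / 2)) * basisFn h m (-(h / 2))

/-- `H₊₁`: contribution of `q_{j+1}` (its left trace, seen at the right end of `I_j`). -/
def divPlus (k : ℕ) (h : ℝ) : Matrix (Fin (k + 1)) (Fin (k + 1)) ℝ :=
  Matrix.of fun m l => basisFn h l (-(h / 2)) * basisFn h m (h / 2)

/-! Eliminating `q` gives `M (u_tt)_j + K₀ u_j + K₋₁ u_{j-1} + K₊₁ u_{j+1} = 0`. -/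

/-- The stiffness block `K₀`. -/
def stiffZero (k : ℕ) (h : ℝ) : Matrix (Fin (k + 1)) (Fin (k + 1)) ℝ :=
  -(divZero k h * (massMatrix k h)⁻¹ * gradZero k h
    + divPlus k h * (massMatrix k h)⁻¹ * gradMinus k h)

/-- The stiffness block `K₋₁`. -/
def stiffMinus (k : ℕ) (h : ℝ) : Matrix (Fin (k + 1)) (Fin (k + 1)) ℝ :=
  -(divZero k h * (massMatrix k h)⁻¹ * gradMinus k h)

/-- The stiffness block `K₊₁`. -/
def stiffPlus (k : ℕ) (h : ℝ) : Matrix (Fin (k + 1)) (Fin (k + 1)) ℝ :=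
  -(divPlus k h * (massMatrix k h)⁻¹ * gradZero k h)

/-- The mass matrix with complex entries. -/
def massC (k : ℕ) (h : ℝ) : Matrix (Fin (k + 1)) (Fin (k + 1)) ℂ :=
  (massMatrix k h).map Complex.ofReal

/-- The symbol `𝒦(ξ) = K₀ + K₋₁ e^{-iξh} + K₊₁ e^{iξh}`. -/
def symbol (k : ℕ) (h ξ : ℝ) : Matrix (Fin (k + 1)) (Fin (k + 1)) ℂ :=
  (stiffZero k h).map Complex.ofReal
    + Complex.exp (-(Complex.I * (ξ * h : ℝ))) • (stiffMinus k h).map Complex.ofReal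
    + Complex.exp (Complex.I * (ξ * h : ℝ)) • (stiffPlus k h).map Complex.ofReal

/-- `(s, v)` solves the generalized eigenvalue equation `(𝒦(ξ) - s M) v = 0` with `v ≠ 0`. -/
def IsEigenpair (k : ℕ) (h ξ s : ℝ) (v : Fin (k + 1) → ℂ) : Prop :=
  v ≠ 0 ∧ symbol k h ξ *ᵥ v = (s : ℂ) • (massC k h *ᵥ v)

/-- The frequency domain `Π_h = [-π/h, π/h]`. -/
def freqDomain (h : ℝ) : Set ℝ := Set.Icc (-(Real.pi / h)) (Real.pi / h)

/-- The stability condition `max σ ≤ 4 / Δt²`, over all eigenvalues at all frequencies. -/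
def Stable (k : ℕ) (h Δt : ℝ) : Prop :=
  ∀ ξ ∈ freqDomain h, ∀ s : ℝ, ∀ v : Fin (k + 1) → ℂ, IsEigenpair k h ξ s v → s ≤ 4 / Δt ^ 2

/-- `σ` is a complete family of `k + 1` real-analytic eigenvalue branches on `Π_h` and `ph` is the
index of a branch vanishing at `ξ = 0` (the physical one). Completeness: at every frequency the
values `σ_j(ξ)` belong to an `M`-orthonormal basis of eigenvectors `v_j`. The eigenvectors are not
asked to depend analytically on `ξ`, so every family of analytic eigenpairs qualifies. -/
structure IsModeFamily (k : ℕ) (h : ℝ) (σ : Fin (k + 1) → ℝ → ℝ) (ph : Fin (k + 1)) : Prop where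
  analytic : ∀ j, AnalyticOn ℝ (σ j) (freqDomain h)
  eigenbasis : ∀ ξ ∈ freqDomain h, ∃ v : Fin (k + 1) → Fin (k + 1) → ℂ,
    (∀ j, IsEigenpair k h ξ (σ j ξ) (v j)) ∧
    ∀ i j, star (v i) ⬝ᵥ (massC k h *ᵥ v j) = if i = j then 1 else 0
  physical : σ ph 0 = 0

/-- The discrete temporal frequency `ω(ξ) = sign(ξ) (2/Δt) arcsin(√σ(ξ) Δt / 2)`. -/
def temporalFreq (Δt : ℝ) (σ : ℝ → ℝ) (ξ : ℝ) : ℝ :=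
  Real.sign ξ * (2 / Δt) * Real.arcsin (Real.sqrt (σ ξ) * Δt / 2)

/-- The group velocity `dω/dξ` exists near the limit described by `l`, and tends to `c` there. -/
def GroupVelocityTendsto (ω : ℝ → ℝ) (l : Filter ℝ) (c : ℝ) : Prop :=
  (∀ᶠ ξ in l, DifferentiableAt ℝ ω ξ) ∧ Tendsto (deriv ω) l (𝓝 c)

end LDG

end

section

open Filter Topology Matrix
open Polynomial
open scoped ContDiff ComplexOrder MatrixOrder

namespace LDG

/-! On the cell (-1, 1), with Bloch phase z = e^{-iξh}, an eigenvector becomes a pair (U, Q) of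
polynomials of degree at most k. Alternating fluxes make the discrete divergence minus the adjoint
of the gradient G (`divC_eq`), so the symbol is G*M⁻¹G: Hermitian and nonnegative.

The key fact is that every eigenvalue is simple. If s ≠ 0 and U has no interface jump, an energy
argument removes the jump of Q as well (`flux_eq`). Then U' = (h/2)Q and Q' = -s(h/2)U, which is
impossible for nonzero polynomials. If s = 0, U is constant. In either case one linear functional is
injective on the eigenspace (`exists_functional_ne_zero`, `eigenvalue_injective`).

Simplicity is used three times. The implicit function theorem makes the ordered eigenvalues analytic
(`analyticAt_sortedEigenvalue`). The characteristic function is even and 2π/h-periodic in ξ, so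
every branch is stationary at 0 and ±π/h (`derivWithin_eq_zero`). Branches never cross, so the
physical one stays lowest (`physical_lt`).

By the chain rule the group velocity is sign(ξ) σ' / (2√σ √(1 - σΔt²/4)), which tends to 0 where 0 <
σ < 4/Δt² in the limit. Spurious branches are positive, and the value 4/Δt² means |ω| → π/Δt. At
±π/h the physical branch reaches 4/Δt² only if k = 0 and Δt = h, when ω(ξ) = ξ. At 0 both factors
degenerate, and σ ~ ξ² is needed (`tendsto_physical_div_sq`): testing the gradient equation with 1
relates ∫Q to (1 - z)U(1), and by compactness U and Q/√σ approach constants of known modulus. -/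

/-! ### Integration and conjugation of polynomials on the reference cell -/

/-- The integral of a complex polynomial over the reference cell `(-1, 1)`. -/
noncomputable def refInt : ℂ[X] →ₗ[ℂ] ℂ where
  toFun p := ∫ t in (-1 : ℝ)..1, p.eval (t : ℂ)
  map_add' p q := by
    simp only [eval_add]
    refine intervalIntegral.integral_add ?_ ?_ <;>
      exact Continuous.intervalIntegrable (by fun_prop) _ _
  map_smul' c p := by
    simp only [eval_smul, RingHom.id_apply]
    exact intervalIntegral.integral_smul _ _

theorem refInt_apply (p : ℂ[X]) : refInt p = ∫ t in (-1 : ℝ)..1, p.eval (t : ℂ) := rfl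

theorem refInt_derivative (p : ℂ[X]) : refInt (derivative p) = p.eval 1 - p.eval (-1) := by
  rw [refInt_apply, intervalIntegral.integral_eq_sub_of_hasDerivAt
    (f := fun t : ℝ => p.eval (t : ℂ))]
  · simp
  · intro t _
    exact (p.hasDerivAt (t : ℂ)).comp_ofReal
  · exact Continuous.intervalIntegrable (by fun_prop) _ _

theorem refInt_parts (p q : ℂ[X]) :
    refInt (derivative p * q) + refInt (p * derivative q)
      = p.eval 1 * q.eval 1 - p.eval (-1) * q.eval (-1) := by
  rw [← map_add, ← derivative_mul, refInt_derivative]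
  simp

/-- The polynomial with conjugated coefficients. -/
noncomputable def conjPoly (p : ℂ[X]) : ℂ[X] := p.map (starRingEnd ℂ)

theorem conjPoly_eval_ofReal (p : ℂ[X]) (t : ℝ) :
    (conjPoly p).eval (t : ℂ) = starRingEnd ℂ (p.eval (t : ℂ)) := by
  rw [conjPoly, ← Polynomial.eval_map_apply, Complex.conj_ofReal]

theorem conjPoly_eval_one (p : ℂ[X]) : (conjPoly p).eval 1 = starRingEnd ℂ (p.eval 1) := by
  simpa using conjPoly_eval_ofReal p 1

theorem conjPoly_eval_neg_one (p : ℂ[X]) :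
    (conjPoly p).eval (-1) = starRingEnd ℂ (p.eval (-1)) := by
  simpa using conjPoly_eval_ofReal p (-1)

theorem conjPoly_mul (p q : ℂ[X]) : conjPoly (p * q) = conjPoly p * conjPoly q := by
  simp [conjPoly]

theorem conjPoly_conjPoly (p : ℂ[X]) : conjPoly (conjPoly p) = p := by
  ext n; simp [conjPoly]

theorem derivative_conjPoly (p : ℂ[X]) : derivative (conjPoly p) = conjPoly (derivative p) := by
  simp [conjPoly, derivative_map]

theorem natDegree_conjPoly_le (p : ℂ[X]) : (conjPoly p).natDegree ≤ p.natDegree :=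
  natDegree_map_le

theorem refInt_conjPoly (p : ℂ[X]) : refInt (conjPoly p) = starRingEnd ℂ (refInt p) := by
  simp only [refInt_apply, conjPoly_eval_ofReal,
    intervalIntegral.integral_of_le (by norm_num : (-1 : ℝ) ≤ 1)]
  exact integral_conj

/-- Weighted squared norm of a polynomial: its integral is real and detects the zero polynomial. -/
theorem refInt_mul_conj (r p : ℂ[X]) (w : ℝ → ℝ) (hw : ∀ t : ℝ, r.eval (t : ℂ) = w t) :
    refInt (r * (p * conjPoly p))
      = ((∫ t in (-1 : ℝ)..1, w t * ‖p.eval (t : ℂ)‖ ^ 2 : ℝ) : ℂ) := by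
  rw [refInt_apply, ← intervalIntegral.integral_ofReal]
  congr 1
  ext t
  simp only [eval_mul, conjPoly_eval_ofReal, hw, Complex.mul_conj, Complex.normSq_eq_norm_sq]
  push_cast
  rfl

/-- Positivity of the weight is asked only in the open interval, so that the weights 1 + t and 1 -
t, each vanishing at one end, are allowed. -/
theorem eq_zero_of_weighted_integral (p : ℂ[X]) (w : ℝ → ℝ) (hwc : Continuous w)
    (hw : ∀ t ∈ Set.Ioo (-1 : ℝ) 1, 0 < w t)
    (h0 : ∫ t in (-1 : ℝ)..1, w t * ‖p.eval (t : ℂ)‖ ^ 2 = 0) : p = 0 := by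
  by_contra hp
  obtain ⟨c, hc, hpc⟩ : ∃ c ∈ Set.Ioo (-1 : ℝ) 1, p.eval (c : ℂ) ≠ 0 := by
    by_contra! hall
    refine hp (Polynomial.eq_zero_of_infinite_isRoot p ?_)
    refine Set.Infinite.mono ?_
      ((Set.Ioo_infinite (by norm_num : (-1 : ℝ) < 1)).image Complex.ofReal_injective.injOn)
    rintro _ ⟨c, hc, rfl⟩
    exact hall c hc
  have hwc' : ContinuousOn (fun t : ℝ => w t * ‖p.eval (t : ℂ)‖ ^ 2) (Set.Icc (-1) 1) := by
    apply Continuous.continuousOn; fun_prop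
  have hpos := intervalIntegral.integral_pos (by norm_num : (-1 : ℝ) < 1) hwc'
    (fun t ht => ?_) ⟨c, ⟨hc.1.le, hc.2.le⟩, mul_pos (hw c hc) (by positivity)⟩
  · exact hpos.ne' h0
  · refine mul_nonneg ?_ (by positivity)
    have : Set.Icc (-1 : ℝ) 1 ⊆ closure {t | 0 ≤ w t} := by
      rw [← closure_Ioo (by norm_num : (-1 : ℝ) ≠ 1)]
      exact closure_mono fun t ht => (hw t ht).le
    rw [(isClosed_le continuous_const hwc).closure_eq] at this
    exact this ⟨ht.1.le, ht.2⟩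

/-- The squared `L²` norm on the reference cell. -/
noncomputable def refNormSq (p : ℂ[X]) : ℝ := ∫ t in (-1 : ℝ)..1, ‖p.eval (t : ℂ)‖ ^ 2

theorem refInt_mul_conj_self (p : ℂ[X]) : refInt (p * conjPoly p) = (refNormSq p : ℂ) := by
  have := refInt_mul_conj 1 p (fun _ => 1) (by simp)
  simpa [refNormSq] using this

theorem refNormSq_nonneg (p : ℂ[X]) : 0 ≤ refNormSq p :=
  intervalIntegral.integral_nonneg (by norm_num) fun _ _ => by positivity

theorem eq_zero_of_refNormSq_eq_zero {p : ℂ[X]} (h0 : refNormSq p = 0) : p = 0 :=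
  eq_zero_of_weighted_integral p (fun _ => 1) continuous_const (fun _ _ => one_pos)
    (by simpa [refNormSq] using h0)

/-! ### Coefficient vectors as polynomials -/

/-- The polynomial `∑ v_l X^l` with coefficient vector `v`. -/
noncomputable def polyOf (k : ℕ) : (Fin (k + 1) → ℂ) →ₗ[ℂ] ℂ[X] :=
  Fintype.linearCombination ℂ (fun l : Fin (k + 1) => (X : ℂ[X]) ^ (l : ℕ))

theorem polyOf_apply {k : ℕ} (v : Fin (k + 1) → ℂ) : polyOf k v = ∑ l, v l • X ^ (l : ℕ) := by
  simp [polyOf, Fintype.linearCombination_apply]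

theorem natDegree_polyOf_le {k : ℕ} (v : Fin (k + 1) → ℂ) : (polyOf k v).natDegree ≤ k := by
  rw [polyOf_apply]
  refine natDegree_sum_le_of_forall_le _ _ fun l _ => ?_
  exact (natDegree_smul_le _ _).trans ((natDegree_X_pow_le _).trans (Nat.lt_succ_iff.mp l.2))

theorem coeff_polyOf {k : ℕ} (v : Fin (k + 1) → ℂ) (l : Fin (k + 1)) :
    (polyOf k v).coeff l = v l := by
  rw [polyOf_apply, finsetSum_coeff, Finset.sum_eq_single l]
  · simp
  · intro b _ hb
    simp [coeff_X_pow, Fin.val_inj, hb.symm]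
  · simp

theorem polyOf_eq_zero {k : ℕ} {v : Fin (k + 1) → ℂ} (hv : polyOf k v = 0) : v = 0 := by
  ext l; rw [← coeff_polyOf v l, hv]; simp

theorem exists_polyOf_eq {k : ℕ} {p : ℂ[X]} (hp : p.natDegree ≤ k) : ∃ v, polyOf k v = p := by
  refine ⟨fun l => p.coeff l, ?_⟩
  rw [polyOf_apply, Fin.sum_univ_eq_sum_range (fun l => p.coeff l • (X : ℂ[X]) ^ l) (k + 1)]
  conv_rhs => rw [p.as_sum_range' (k + 1) (Nat.lt_succ_of_le hp)]
  simp [smul_X_eq_monomial]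

theorem polyOf_star {k : ℕ} (v : Fin (k + 1) → ℂ) : polyOf k (star v) = conjPoly (polyOf k v) := by
  simp [polyOf_apply, conjPoly, Polynomial.map_sum, smul_eq_C_mul]

/-- A matrix whose entries are values of a bilinear form on monomials represents that form. -/
theorem dotProduct_mulVec_of_bilin {k : ℕ} (B : ℂ[X] →ₗ[ℂ] ℂ[X] →ₗ[ℂ] ℂ)
    (A : Matrix (Fin (k + 1)) (Fin (k + 1)) ℂ)
    (hA : ∀ m l, A m l = B (X ^ (m : ℕ)) (X ^ (l : ℕ))) (w u : Fin (k + 1) → ℂ) :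
    w ⬝ᵥ (A *ᵥ u) = B (polyOf k w) (polyOf k u) := by
  simp only [polyOf_apply, map_sum, LinearMap.sum_apply, map_smul, LinearMap.smul_apply,
    dotProduct, mulVec, hA, smul_eq_mul, Finset.mul_sum]
  rw [Finset.sum_comm]
  refine Finset.sum_congr rfl fun l _ => Finset.sum_congr rfl fun m _ => ?_
  ring

/-! ### Symbols of the gradient, the divergence and the mass matrix -/

/-- The phase `e^{-iξh}` gained per cell. -/
noncomputable def phase (h ξ : ℝ) : ℂ := Complex.exp (-(Complex.I * (ξ * h : ℝ)))

theorem conj_phase (h ξ : ℝ) :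
    starRingEnd ℂ (phase h ξ) = Complex.exp (Complex.I * (ξ * h : ℝ)) := by
  rw [phase, ← Complex.exp_conj]
  simp only [map_neg, map_mul, Complex.conj_I, Complex.conj_ofReal, neg_mul, neg_neg]

theorem norm_phase (h ξ : ℝ) : ‖phase h ξ‖ = 1 := by
  rw [phase, ← mul_neg, ← Complex.ofReal_neg, mul_comm, Complex.norm_exp_ofReal_mul_I]

theorem conj_phase_mul (h ξ : ℝ) : starRingEnd ℂ (phase h ξ) * phase h ξ = 1 := by
  rw [mul_comm, Complex.mul_conj, Complex.normSq_eq_norm_sq, norm_phase]; simp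

theorem massC_apply {k : ℕ} {h : ℝ} (hh : 0 < h) (m l : Fin (k + 1)) :
    massC k h m l = (h / 2) * refInt (X ^ (m : ℕ) * X ^ (l : ℕ)) := by
  have h2 : h / 2 ≠ 0 := by positivity
  simp only [massC, massMatrix, map_apply, of_apply, basisFn]
  rw [intervalIntegral.integral_comp_div (fun t : ℝ => t ^ (l : ℕ) * t ^ (m : ℕ)) h2, neg_div,
    div_self h2, refInt_apply, smul_eq_mul]
  push_cast [← intervalIntegral.integral_ofReal]
  simp [mul_comm]

theorem volumeMatrix_apply {k : ℕ} {h : ℝ} (hh : 0 < h) (m l : Fin (k + 1)) :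
    (volumeMatrix k h m l : ℂ) = -refInt (derivative (X ^ (m : ℕ)) * X ^ (l : ℕ)) := by
  have h2 : h / 2 ≠ 0 := by positivity
  have hd : ∀ x : ℝ, deriv (basisFn h m) x
      = (h / 2)⁻¹ * (fun t : ℝ => (m : ℕ) * t ^ ((m : ℕ) - 1)) (x / (h / 2)) := by
    intro x
    have : HasDerivAt (basisFn h m) (((m : ℕ) : ℝ) * (x / (h / 2)) ^ ((m : ℕ) - 1) * (1 / (h / 2))) x :=
      ((hasDerivAt_id x).div_const (h / 2)).fun_pow (m : ℕ)
    rw [this.deriv]; simp; ring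
  simp only [volumeMatrix, of_apply, hd, basisFn]
  have : ∀ x : ℝ, (x / (h / 2)) ^ (l : ℕ) *
      ((h / 2)⁻¹ * (((m : ℕ) : ℝ) * (x / (h / 2)) ^ ((m : ℕ) - 1)))
      = (h / 2)⁻¹ * (fun t : ℝ => ((m : ℕ) : ℝ) * t ^ ((m : ℕ) - 1) * t ^ (l : ℕ)) (x / (h / 2)) := by
    intro x; ring
  simp only [this, intervalIntegral.integral_const_mul]
  rw [intervalIntegral.integral_comp_div
    (fun t : ℝ => ((m : ℕ) : ℝ) * t ^ ((m : ℕ) - 1) * t ^ (l : ℕ)) h2, neg_div, div_self h2,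
    refInt_apply, smul_eq_mul, inv_mul_cancel_left₀ h2]
  push_cast [← intervalIntegral.integral_ofReal]
  simp [derivative_X_pow]

/-- The symbol of the discrete gradient. -/
noncomputable def gradC (k : ℕ) (h ξ : ℝ) : Matrix (Fin (k + 1)) (Fin (k + 1)) ℂ :=
  (gradZero k h).map Complex.ofReal + phase h ξ • (gradMinus k h).map Complex.ofReal

/-- The symbol of the discrete divergence. -/
noncomputable def divC (k : ℕ) (h ξ : ℝ) : Matrix (Fin (k + 1)) (Fin (k + 1)) ℂ :=
  (divZero k h).map Complex.ofReal + starRingEnd ℂ (phase h ξ) • (divPlus k h).map Complex.ofReal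

/-- The bilinear form of the discrete gradient; the test function comes first. -/
noncomputable def gradForm (z : ℂ) : ℂ[X] →ₗ[ℂ] ℂ[X] →ₗ[ℂ] ℂ :=
  LinearMap.mk₂ ℂ
    (fun w u => refInt (derivative u * w) + (u.eval (-1) - z * u.eval 1) * w.eval (-1))
    (fun _ _ _ => by simp [mul_add]; ring) (fun _ _ _ => by simp; ring)
    (fun _ _ _ => by simp [add_mul]; ring) (fun _ _ _ => by simp; ring)

/-- The bilinear form of the discrete divergence; the test function comes first. -/
noncomputable def divForm (z : ℂ) : ℂ[X] →ₗ[ℂ] ℂ[X] →ₗ[ℂ] ℂ :=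
  LinearMap.mk₂ ℂ
    (fun w q => refInt (derivative q * w)
      + (starRingEnd ℂ z * q.eval (-1) - q.eval 1) * w.eval 1)
    (fun _ _ _ => by simp [mul_add]; ring) (fun _ _ _ => by simp; ring)
    (fun _ _ _ => by simp [add_mul]; ring) (fun _ _ _ => by simp; ring)

/-- The bilinear form of the mass matrix. -/
noncomputable def massForm (h : ℝ) : ℂ[X] →ₗ[ℂ] ℂ[X] →ₗ[ℂ] ℂ :=
  LinearMap.mk₂ ℂ (fun w u => (h / 2) * refInt (w * u))
    (fun _ _ _ => by simp [add_mul, mul_add]) (fun _ _ _ => by simp; ring)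
    (fun _ _ _ => by simp [mul_add]) (fun _ _ _ => by simp; ring)

theorem basisFn_right {h : ℝ} (hh : 0 < h) (m : ℕ) : basisFn h m (h / 2) = 1 := by
  have h2 : h / 2 ≠ 0 := by positivity
  simp [basisFn, div_self h2]

theorem basisFn_left {h : ℝ} (hh : 0 < h) (m : ℕ) : basisFn h m (-(h / 2)) = (-1) ^ m := by
  have h2 : h / 2 ≠ 0 := by positivity
  simp [basisFn, neg_div, div_self h2]

/-- Integrating the volume term by parts passes to the strong form, in which the only boundary
contribution is the jump at the left end. -/
theorem gradC_apply {k : ℕ} {h : ℝ} (hh : 0 < h) (ξ : ℝ) (m l : Fin (k + 1)) :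
    gradC k h ξ m l = gradForm (phase h ξ) (X ^ (m : ℕ)) (X ^ (l : ℕ)) := by
  simp only [gradC, gradZero, gradMinus, Matrix.add_apply, map_apply, Matrix.smul_apply, of_apply,
    basisFn_right hh, basisFn_left hh, gradForm, LinearMap.mk₂_apply]
  push_cast [volumeMatrix_apply hh]
  have := refInt_parts (X ^ (m : ℕ)) (X ^ (l : ℕ))
  rw [mul_comm (X ^ (m : ℕ)) (derivative _)] at this
  simp only [eval_pow, eval_X, one_pow, mul_one, smul_eq_mul] at this ⊢
  linear_combination -this

theorem divC_apply {k : ℕ} {h : ℝ} (hh : 0 < h) (ξ : ℝ) (m l : Fin (k + 1)) :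
    divC k h ξ m l = divForm (phase h ξ) (X ^ (m : ℕ)) (X ^ (l : ℕ)) := by
  simp only [divC, divZero, divPlus, Matrix.add_apply, Matrix.sub_apply, map_apply, Matrix.smul_apply, of_apply,
    basisFn_right hh, basisFn_left hh, divForm, LinearMap.mk₂_apply]
  push_cast [volumeMatrix_apply hh]
  have := refInt_parts (X ^ (m : ℕ)) (X ^ (l : ℕ))
  rw [mul_comm (X ^ (m : ℕ)) (derivative _)] at this
  simp only [eval_pow, eval_X, one_pow, mul_one, smul_eq_mul] at this ⊢
  linear_combination -this

theorem massC_inner {k : ℕ} {h : ℝ} (hh : 0 < h) (w u : Fin (k + 1) → ℂ) :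
    w ⬝ᵥ (massC k h *ᵥ u) = (h / 2) * refInt (polyOf k w * polyOf k u) :=
  dotProduct_mulVec_of_bilin (massForm h) _ (fun m l => by simp [massC_apply hh, massForm]) w u

theorem gradC_inner {k : ℕ} {h : ℝ} (hh : 0 < h) (ξ : ℝ) (w u : Fin (k + 1) → ℂ) :
    w ⬝ᵥ (gradC k h ξ *ᵥ u) = gradForm (phase h ξ) (polyOf k w) (polyOf k u) :=
  dotProduct_mulVec_of_bilin _ _ (gradC_apply hh ξ) w u

theorem divC_inner {k : ℕ} {h : ℝ} (hh : 0 < h) (ξ : ℝ) (w u : Fin (k + 1) → ℂ) :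
    w ⬝ᵥ (divC k h ξ *ᵥ u) = divForm (phase h ξ) (polyOf k w) (polyOf k u) :=
  dotProduct_mulVec_of_bilin _ _ (divC_apply hh ξ) w u

theorem conj_refInt_of_conjPoly_eq (p : ℂ[X]) (hp : conjPoly p = p) :
    starRingEnd ℂ (refInt p) = refInt p := by
  rw [← refInt_conjPoly, hp]

/-- This is where the alternating fluxes enter: after integration by parts, the boundary terms of
the two forms cancel exactly. -/
theorem divC_eq {k : ℕ} {h : ℝ} (hh : 0 < h) (ξ : ℝ) : divC k h ξ = -(gradC k h ξ)ᴴ := by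
  ext m l
  rw [neg_apply, conjTranspose_apply, divC_apply hh, gradC_apply hh]
  have := refInt_parts (X ^ (m : ℕ)) (X ^ (l : ℕ))
  rw [mul_comm (X ^ (m : ℕ)) (derivative _)] at this
  have hc := conj_refInt_of_conjPoly_eq (derivative (X ^ (m : ℕ)) * X ^ (l : ℕ)) (by simp [conjPoly, derivative_X_pow])
  simp only [divForm, gradForm, LinearMap.mk₂_apply, ← starRingEnd_apply, hc, map_mul,
    map_sub, map_pow, map_neg, map_one, eval_pow, eval_X, one_pow, mul_one, map_add] at this ⊢
  linear_combination this

theorem massC_posDef {k : ℕ} {h : ℝ} (hh : 0 < h) : (massC k h).PosDef := by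
  refine Matrix.PosDef.of_dotProduct_mulVec_pos ?_ fun {v} hv => ?_
  · ext m l
    rw [conjTranspose_apply, massC_apply hh, massC_apply hh]
    have hc := conj_refInt_of_conjPoly_eq (X ^ (l : ℕ) * X ^ (m : ℕ)) (by simp [conjPoly])
    simp only [← starRingEnd_apply, map_mul, hc, map_div₀, Complex.conj_ofReal]
    rw [mul_comm (X ^ (l : ℕ)), Complex.conj_ofNat]
  · rw [massC_inner hh, polyOf_star, mul_comm (conjPoly _), refInt_mul_conj_self]
    have : 0 < refNormSq (polyOf k v) :=
      lt_of_le_of_ne (refNormSq_nonneg _) fun h0 =>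
        hv (polyOf_eq_zero (eq_zero_of_refNormSq_eq_zero h0.symm))
    have : 0 < h / 2 * refNormSq (polyOf k v) := by positivity
    exact_mod_cast this

theorem massC_inv (k : ℕ) (h : ℝ) :
    (massC k h)⁻¹ = ((massMatrix k h)⁻¹).map Complex.ofReal := by
  have hdet : (massC k h).det = ((massMatrix k h).det : ℂ) :=
    (RingHom.map_det Complex.ofRealHom (massMatrix k h)).symm
  have hadj : (massC k h).adjugate = (massMatrix k h).adjugate.map Complex.ofReal :=
    (RingHom.map_adjugate Complex.ofRealHom (massMatrix k h)).symm
  ext i j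
  simp [Matrix.inv_def, hdet, hadj, Ring.inverse_eq_inv']

/-- Of the four terms of the expanded product, the one carrying both phases loses them, because |z|
= 1, and joins `stiffZero`. -/
theorem symbol_eq_div_mul_grad (k : ℕ) (h ξ : ℝ) :
    symbol k h ξ = -(divC k h ξ * (massC k h)⁻¹ * gradC k h ξ) := by
  have hz := conj_phase_mul h ξ
  have e : ∀ A B C : Matrix (Fin (k + 1)) (Fin (k + 1)) ℝ, (A * B * C).map Complex.ofReal
      = A.map Complex.ofReal * B.map Complex.ofReal * C.map Complex.ofReal := fun A B C => by
    rw [show (Complex.ofReal) = ⇑Complex.ofRealHom from rfl, Matrix.map_mul, Matrix.map_mul]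
  have en : ∀ A : Matrix (Fin (k + 1)) (Fin (k + 1)) ℝ, (-A).map Complex.ofReal
      = -A.map Complex.ofReal := fun A => by ext; simp
  have ea : ∀ A B : Matrix (Fin (k + 1)) (Fin (k + 1)) ℝ, (A + B).map Complex.ofReal
      = A.map Complex.ofReal + B.map Complex.ofReal := fun A B => by ext; simp
  rw [symbol, ← conj_phase, ← phase, massC_inv]
  simp only [stiffZero, stiffMinus, stiffPlus, gradC, divC, en, ea, e, add_mul, mul_add,
    smul_mul_assoc, mul_smul_comm, smul_neg, neg_add, smul_add]
  rw [smul_smul, mul_comm (phase h ξ), hz, one_smul]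
  abel

/-- The matrix symbol in manifestly Hermitian form. -/
theorem symbol_eq {k : ℕ} {h : ℝ} (hh : 0 < h) (ξ : ℝ) :
    symbol k h ξ = (gradC k h ξ)ᴴ * (massC k h)⁻¹ * gradC k h ξ := by
  rw [symbol_eq_div_mul_grad, divC_eq hh, neg_mul, neg_mul, neg_neg]

theorem symbol_isHermitian {k : ℕ} {h : ℝ} (hh : 0 < h) (ξ : ℝ) : (symbol k h ξ).IsHermitian := by
  have hM : ((massC k h)⁻¹)ᴴ = (massC k h)⁻¹ := (massC_posDef hh).inv.isHermitian
  rw [symbol_eq hh, IsHermitian]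
  simp only [conjTranspose_mul, conjTranspose_conjTranspose, hM, Matrix.mul_assoc]

/-! ### The weak eigenvalue problem and its energy identities -/

/-- The weak formulation of the eigenvalue problem for the pair `(U, Q)` of polynomials on the
reference cell, with Bloch phase `z`. -/
structure IsModePair (k : ℕ) (h : ℝ) (z : ℂ) (s : ℝ) (U Q : ℂ[X]) : Prop where
  degU : U.natDegree ≤ k
  degQ : Q.natDegree ≤ k
  grad : ∀ W : ℂ[X], W.natDegree ≤ k →
    (h / 2 : ℂ) * refInt (W * Q)
      = refInt (derivative U * W) + (U.eval (-1) - z * U.eval 1) * W.eval (-1)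
  div : ∀ W : ℂ[X], W.natDegree ≤ k →
    -s * ((h / 2 : ℂ) * refInt (W * U))
      = refInt (derivative Q * W) + (starRingEnd ℂ z * Q.eval (-1) - Q.eval 1) * W.eval 1

/-- The discrete derivative attached to a coefficient vector. -/
noncomputable def gradVec (k : ℕ) (h ξ : ℝ) (u : Fin (k + 1) → ℂ) : Fin (k + 1) → ℂ :=
  (massC k h)⁻¹ *ᵥ (gradC k h ξ *ᵥ u)

theorem massC_isUnit_det {k : ℕ} {h : ℝ} (hh : 0 < h) : IsUnit (massC k h).det :=
  (Matrix.isUnit_iff_isUnit_det _).mp (massC_posDef hh).isUnit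

theorem massC_mulVec_gradVec {k : ℕ} {h : ℝ} (hh : 0 < h) (ξ : ℝ) (u : Fin (k + 1) → ℂ) :
    massC k h *ᵥ gradVec k h ξ u = gradC k h ξ *ᵥ u := by
  rw [gradVec, mulVec_mulVec, Matrix.mul_nonsing_inv _ (massC_isUnit_det hh), one_mulVec]

theorem divC_mulVec_gradVec {k : ℕ} {h ξ s : ℝ} {u : Fin (k + 1) → ℂ}
    (hu : IsEigenpair k h ξ s u) :
    divC k h ξ *ᵥ gradVec k h ξ u = (-s : ℂ) • (massC k h *ᵥ u) := by
  rw [neg_smul, ← hu.2, symbol_eq_div_mul_grad, neg_mulVec, neg_neg, gradVec, mulVec_mulVec,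
    mulVec_mulVec]

theorem IsEigenpair.isModePair {k : ℕ} {h ξ s : ℝ} (hh : 0 < h) {u : Fin (k + 1) → ℂ}
    (hu : IsEigenpair k h ξ s u) :
    IsModePair k h (phase h ξ) s (polyOf k u) (polyOf k (gradVec k h ξ u)) where
  degU := natDegree_polyOf_le _
  degQ := natDegree_polyOf_le _
  grad W hW := by
    obtain ⟨w, rfl⟩ := exists_polyOf_eq hW
    rw [← massC_inner hh, massC_mulVec_gradVec hh, gradC_inner hh]
    simp [gradForm]
  div W hW := by
    obtain ⟨w, rfl⟩ := exists_polyOf_eq hW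
    rw [← massC_inner hh, ← smul_eq_mul, ← dotProduct_smul, ← divC_mulVec_gradVec hu,
      divC_inner hh]
    simp [divForm]

theorem eq_zero_of_refInt_mul {k : ℕ} {p : ℂ[X]} (hp : p.natDegree ≤ k)
    (h0 : ∀ W : ℂ[X], W.natDegree ≤ k → refInt (W * p) = 0) : p = 0 := by
  have := h0 (conjPoly p) ((natDegree_conjPoly_le p).trans hp)
  rw [mul_comm, refInt_mul_conj_self] at this
  exact eq_zero_of_refNormSq_eq_zero (by exact_mod_cast this)

/-- The integrand has real part (|p|²)'/2. -/
theorem re_refInt_derivative_mul_conj (p : ℂ[X]) :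
    2 * (refInt (derivative p * conjPoly p)).re = ‖p.eval 1‖ ^ 2 - ‖p.eval (-1)‖ ^ 2 := by
  have h1 := refInt_parts p (conjPoly p)
  have h2 : refInt (p * derivative (conjPoly p))
      = starRingEnd ℂ (refInt (derivative p * conjPoly p)) := by
    rw [← refInt_conjPoly, conjPoly_mul, conjPoly_conjPoly, derivative_conjPoly, mul_comm]
  rw [h2, conjPoly_eval_one, conjPoly_eval_neg_one, Complex.mul_conj, Complex.mul_conj,
    Complex.normSq_eq_norm_sq, Complex.normSq_eq_norm_sq, Complex.add_conj] at h1
  exact_mod_cast h1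

theorem natDegree_derivative_le_of_le {k : ℕ} {p : ℂ[X]} (hp : p.natDegree ≤ k) :
    (derivative p).natDegree ≤ k :=
  (natDegree_derivative_le p).trans ((Nat.sub_le _ _).trans hp)

/-- The derivative gives back the degree that the linear factor costs, so these products are
admissible test functions; for constant p the product is 0. -/
theorem natDegree_linear_mul_le {k : ℕ} {p r : ℂ[X]} (hp : p.natDegree ≤ k)
    (hr : r.natDegree ≤ 1) : (r * conjPoly (derivative p)).natDegree ≤ k := by
  rcases Nat.eq_zero_or_pos p.natDegree with h0 | h0
  · rw [eq_C_of_natDegree_eq_zero h0]; simp [conjPoly]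
  · have h1 := natDegree_mul_le (p := r) (q := conjPoly (derivative p))
    have h2 := natDegree_conjPoly_le (derivative p)
    have h3 := natDegree_derivative_le p
    omega

theorem eq_C_of_derivative_eq_zero {p : ℂ[X]} (h0 : derivative p = 0) : p = C (p.eval 1) := by
  have := eq_C_of_natDegree_eq_zero (derivative_eq_zero.mp h0)
  rw [this]; simp

/-- The kernel of the discrete gradient consists of constants. -/
theorem derivative_eq_zero_of_grad {k : ℕ} {U : ℂ[X]} (hU : U.natDegree ≤ k) {a : ℂ}
    (h0 : ∀ W : ℂ[X], W.natDegree ≤ k → refInt (derivative U * W) + a * W.eval (-1) = 0) :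
    derivative U = 0 := by
  have hd : (X + 1 : ℂ[X]).natDegree ≤ 1 := by
    rw [← C_1]; exact (natDegree_X_add_C (1 : ℂ)).le
  -- The test function (1 + x) times the conjugate of U' vanishes at -1: the unknown jump a drops
  -- out and a weighted norm of U' remains.
  have h1 := h0 _ (natDegree_linear_mul_le hU hd)
  rw [show derivative U * ((X + 1) * conjPoly (derivative U))
    = (X + 1) * (derivative U * conjPoly (derivative U)) by ring,
    refInt_mul_conj _ _ (fun t => t + 1) (by simp)] at h1
  simp only [eval_mul, eval_add, eval_X, eval_one, neg_add_cancel, zero_mul, mul_zero,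
    add_zero] at h1
  exact eq_zero_of_weighted_integral _ (fun t => t + 1) (by fun_prop)
    (fun t ht => by linarith [ht.1])
    (by exact_mod_cast h1)

/-- The kernel of the discrete divergence consists of constants. -/
theorem derivative_eq_zero_of_div {k : ℕ} {Q : ℂ[X]} (hQ : Q.natDegree ≤ k) {b : ℂ}
    (h0 : ∀ W : ℂ[X], W.natDegree ≤ k → refInt (derivative Q * W) + b * W.eval 1 = 0) :
    derivative Q = 0 := by
  have hd : (1 - X : ℂ[X]).natDegree ≤ 1 :=
    (natDegree_sub_le _ _).trans (by simp)
  have h1 := h0 _ (natDegree_linear_mul_le hQ hd)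
  rw [show derivative Q * ((1 - X) * conjPoly (derivative Q))
    = (1 - X) * (derivative Q * conjPoly (derivative Q)) by ring,
    refInt_mul_conj _ _ (fun t => 1 - t) (by simp)] at h1
  simp only [eval_mul, eval_sub, eval_X, eval_one, sub_self, zero_mul, mul_zero,
    add_zero] at h1
  exact eq_zero_of_weighted_integral _ (fun t => 1 - t) (by fun_prop)
    (fun t ht => by linarith [ht.2])
    (by exact_mod_cast h1)

namespace IsModePair

variable {k : ℕ} {h : ℝ} {z : ℂ} {s : ℝ} {U Q : ℂ[X]}

/-- Without the jump, U' - (h/2)Q is orthogonal to all polynomials of degree at most k, and it is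
one of them. -/
theorem derivative_eq (hp : IsModePair k h z s U Q) (ha : U.eval (-1) = z * U.eval 1) :
    derivative U = C (h / 2 : ℂ) * Q := by
  rw [← sub_eq_zero]
  refine eq_zero_of_refInt_mul (k := k) ?_ fun W hW => ?_
  · refine natDegree_sub_le_of_le (natDegree_derivative_le_of_le hp.degU) ?_ |>.trans (max_self k).le
    exact (natDegree_C_mul_le _ _).trans hp.degQ
  · have := hp.grad W hW
    rw [ha, sub_self, zero_mul, add_zero] at this
    rw [mul_sub, map_sub, mul_left_comm, ← smul_eq_C_mul, map_smul, smul_eq_mul, this, mul_comm W,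
      sub_self]

/-- If the scalar unknown has no interface defect, then neither has the flux unknown. -/
theorem flux_eq (hp : IsModePair k h z s U Q) (hz : ‖z‖ = 1)
    (ha : U.eval (-1) = z * U.eval 1) : Q.eval 1 = starRingEnd ℂ z * Q.eval (-1) := by
  have hU := hp.derivative_eq ha
  -- Real parts of the divergence equation tested with the conjugate of Q: the left side vanishes
  -- because |U(-1)| = |U(1)|. For the flux jump b, combining the rest with |Q(-1)| = |b + Q(1)|
  -- leaves |b|² = 0.
  have h1 := hp.div (conjPoly Q) ((natDegree_conjPoly_le Q).trans hp.degQ)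
  have h2 : (h / 2 : ℂ) * refInt (conjPoly Q * U)
      = starRingEnd ℂ (refInt (derivative U * conjPoly U)) := by
    rw [← refInt_conjPoly, conjPoly_mul, conjPoly_conjPoly, hU, ← smul_eq_mul, ← map_smul,
      smul_eq_C_mul, conjPoly_mul]
    simp [conjPoly, mul_assoc, Complex.conj_ofNat]
  have h3 := re_refInt_derivative_mul_conj U
  have h4 := re_refInt_derivative_mul_conj Q
  rw [ha, norm_mul, hz, one_mul, sub_self] at h3
  have h5 : (refInt (derivative U * conjPoly U)).re = 0 := by linarith
  rw [h2] at h1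
  set b := starRingEnd ℂ z * Q.eval (-1) - Q.eval 1 with hb
  have h6 : ‖Q.eval (-1)‖ ^ 2 = ‖b + Q.eval 1‖ ^ 2 := by
    rw [hb, sub_add_cancel, norm_mul, RCLike.norm_conj, hz, one_mul]
  have h7 := congrArg Complex.re h1
  rw [conjPoly_eval_one, ← Complex.ofReal_neg, Complex.re_ofReal_mul, Complex.conj_re, h5,
    Complex.add_re] at h7
  rw [← Complex.normSq_eq_norm_sq, ← Complex.normSq_eq_norm_sq, Complex.normSq_add,
    Complex.normSq_eq_norm_sq (Q.eval 1)] at h6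
  rw [← Complex.normSq_eq_norm_sq (Q.eval (-1))] at h4
  have h8 : Complex.normSq b = 0 := by linarith
  rw [Complex.normSq_eq_zero, hb, sub_eq_zero] at h8
  exact h8.symm

theorem derivative_flux_eq (hp : IsModePair k h z s U Q)
    (hb : Q.eval 1 = starRingEnd ℂ z * Q.eval (-1)) :
    derivative Q = C (-s * (h / 2) : ℂ) * U := by
  rw [← sub_eq_zero]
  refine eq_zero_of_refInt_mul (k := k) ?_ fun W hW => ?_
  · refine natDegree_sub_le_of_le (natDegree_derivative_le_of_le hp.degQ) ?_ |>.trans (max_self k).le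
    exact (natDegree_C_mul_le _ _).trans hp.degU
  · have := hp.div W hW
    rw [hb, sub_self, zero_mul, add_zero] at this
    rw [mul_sub, map_sub, mul_left_comm, ← smul_eq_C_mul, map_smul, smul_eq_mul, mul_assoc, this,
      mul_comm W, sub_self]

/-- U' and Q' are nonzero multiples of Q and U, so for nonconstant U each degree would be strictly
below the other. For constant U, first Q = 0 and then U = 0. -/
theorem eq_zero_of_jump_eq_zero (hp : IsModePair k h z s U Q) (hh : 0 < h) (hs : s ≠ 0)
    (hz : ‖z‖ = 1) (ha : U.eval (-1) = z * U.eval 1) : U = 0 := by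
  have hU := hp.derivative_eq ha
  have hQ := hp.derivative_flux_eq (hp.flux_eq hz ha)
  have hc : (-s * (h / 2) : ℂ) ≠ 0 := by
    have : -s * (h / 2) ≠ 0 := mul_ne_zero (neg_ne_zero.mpr hs) (by positivity)
    exact_mod_cast this
  have hc' : (h / 2 : ℂ) ≠ 0 := by
    have : h / 2 ≠ 0 := by positivity
    exact_mod_cast this
  have h1 := natDegree_C_mul (p := U) hc
  have h2 := natDegree_C_mul (p := Q) hc'
  rw [← hQ] at h1
  rw [← hU] at h2
  rcases Nat.eq_zero_or_pos U.natDegree with h0 | h0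
  · rw [eq_C_of_natDegree_eq_zero h0, derivative_C, eq_comm, mul_eq_zero] at hU
    have hQ0 : Q = 0 := hU.resolve_left (C_ne_zero.mpr hc')
    rw [hQ0, derivative_zero, eq_comm, mul_eq_zero] at hQ
    exact hQ.resolve_left (C_ne_zero.mpr hc)
  · have h3 := natDegree_derivative_le U
    have h4 := natDegree_derivative_le Q
    omega

/-- Energy identity. -/
theorem refNormSq_flux (hp : IsModePair k h z s U Q) (hh : 0 < h) :
    refNormSq Q = s * refNormSq U := by
  -- Adding the conjugated divergence equation, tested with the conjugate of U, cancels all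
  -- interface terms against those of integration by parts.
  have h1 := hp.grad (conjPoly Q) ((natDegree_conjPoly_le Q).trans hp.degQ)
  have h2 := congrArg (starRingEnd ℂ)
    (hp.div (conjPoly U) ((natDegree_conjPoly_le U).trans hp.degU))
  have h3 := refInt_parts U (conjPoly Q)
  have h4 : starRingEnd ℂ (refInt (derivative Q * conjPoly U))
      = refInt (U * derivative (conjPoly Q)) := by
    rw [← refInt_conjPoly, conjPoly_mul, conjPoly_conjPoly, derivative_conjPoly, mul_comm]
  rw [mul_comm (conjPoly Q) Q, refInt_mul_conj_self] at h1
  rw [mul_comm (conjPoly U) U, refInt_mul_conj_self] at h2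
  simp only [map_mul, map_add, map_sub, map_neg, map_div₀, Complex.conj_ofReal, Complex.conj_conj,
    Complex.conj_ofNat, h4, conjPoly_eval_one, conjPoly_eval_neg_one] at h1 h2 h3
  have h5 : (h / 2 : ℂ) * (refNormSq Q - s * refNormSq U) = 0 := by linear_combination h1 + h2 + h3
  have h6 : h / 2 * (refNormSq Q - s * refNormSq U) = 0 := by exact_mod_cast h5
  have h7 := (mul_eq_zero.mp h6).resolve_left (by positivity)
  linarith

theorem nonneg (hp : IsModePair k h z s U Q) (hh : 0 < h) (hU : U ≠ 0) : 0 ≤ s := by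
  have h1 := hp.refNormSq_flux hh
  have h2 := refNormSq_nonneg Q
  have h3 : 0 < refNormSq U :=
    lt_of_le_of_ne (refNormSq_nonneg _) fun h0 => hU (eq_zero_of_refNormSq_eq_zero h0.symm)
  rw [h1] at h2
  exact nonneg_of_mul_nonneg_left h2 h3

/-- The energy identity gives Q = 0, so U lies in the kernel of the gradient. The test function 1
then leaves (1 - z)U(1) = 0. -/
theorem eq_C_of_eq_zero (hp : IsModePair k h z 0 U Q) (hh : 0 < h) :
    U = C (U.eval 1) ∧ (U ≠ 0 → z = 1) := by
  have hQ : Q = 0 := eq_zero_of_refNormSq_eq_zero (by simpa using hp.refNormSq_flux hh)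
  have h1 := hp.grad
  simp only [hQ, mul_zero, map_zero] at h1
  have hd := derivative_eq_zero_of_grad hp.degU fun W hW => (h1 W hW).symm
  have hC := eq_C_of_derivative_eq_zero hd
  refine ⟨hC, fun hU => ?_⟩
  have hne : U.eval 1 ≠ 0 := fun h0 => hU (by rw [hC, h0, C_0])
  have h2 := h1 1 (by simp)
  have h3 : U.eval (-1) = U.eval 1 := by rw [hC]; simp
  rw [hd, h3] at h2
  simp only [map_zero, zero_add, eval_one, mul_one] at h2
  have h4 : (1 - z) * U.eval 1 = 0 := by linear_combination -h2
  exact (sub_eq_zero.mp ((mul_eq_zero.mp h4).resolve_right hne)).symm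

end IsModePair

/-! ### Nonnegativity and simplicity of the spectrum -/

theorem polyOf_ne_zero {k : ℕ} {v : Fin (k + 1) → ℂ} (hv : v ≠ 0) : polyOf k v ≠ 0 :=
  fun h0 => hv (polyOf_eq_zero h0)

theorem IsEigenpair.nonneg {k : ℕ} {h ξ s : ℝ} (hh : 0 < h) {v : Fin (k + 1) → ℂ}
    (hv : IsEigenpair k h ξ s v) : 0 ≤ s :=
  (hv.isModePair hh).nonneg hh (polyOf_ne_zero hv.1)

theorem IsEigenpair.phase_eq_one {k : ℕ} {h ξ : ℝ} (hh : 0 < h) {v : Fin (k + 1) → ℂ}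
    (hv : IsEigenpair k h ξ 0 v) : phase h ξ = 1 :=
  ((hv.isModePair hh).eq_C_of_eq_zero hh).2 (polyOf_ne_zero hv.1)

/-- Some linear functional vanishes at no eigenvector of a given eigenvalue, so that all
eigenvalues are simple. -/
theorem exists_functional_ne_zero (k : ℕ) {h : ℝ} (hh : 0 < h) (ξ s : ℝ) :
    ∃ f : (Fin (k + 1) → ℂ) →ₗ[ℂ] ℂ, ∀ v, IsEigenpair k h ξ s v → f v ≠ 0 := by
  rcases eq_or_ne s 0 with rfl | hs
  · refine ⟨(leval 1).comp (polyOf k), fun v hv h0 => polyOf_ne_zero hv.1 ?_⟩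
    rw [((hv.isModePair hh).eq_C_of_eq_zero hh).1, show eval 1 (polyOf k v) = 0 from h0, C_0]
  -- For s ≠ 0 the functional is the interface jump of U; for s = 0 it was the value at 1.
  · refine ⟨(leval (-1 : ℂ) - phase h ξ • leval (1 : ℂ)).comp (polyOf k),
      fun v hv h0 => polyOf_ne_zero hv.1 ?_⟩
    refine (hv.isModePair hh).eq_zero_of_jump_eq_zero hh hs (norm_phase h ξ) ?_
    simpa [sub_eq_zero] using h0

/-- Two basis vectors with the same eigenvalue have a combination killed by the functional f, hence
zero. Pairing it with the first vector gives f = 0 on the second, a contradiction. -/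
theorem eigenvalue_injective {k : ℕ} {h ξ : ℝ} (hh : 0 < h) {ι : Type*} [DecidableEq ι]
    {σ : ι → ℝ}
    {v : ι → Fin (k + 1) → ℂ} (hv : ∀ j, IsEigenpair k h ξ (σ j) (v j))
    (ho : ∀ i j, star (v i) ⬝ᵥ (massC k h *ᵥ v j) = if i = j then 1 else 0) :
    Function.Injective σ := by
  intro i j hij
  by_contra hne
  obtain ⟨f, hf⟩ := exists_functional_ne_zero k hh ξ (σ i)
  have hi := hf _ (hv i)
  have hj := hf (v j) (hij ▸ hv j)
  have h0 : f (v j) • v i - f (v i) • v j = 0 := by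
    by_contra hw
    refine hf _ ⟨hw, ?_⟩ (by simp [mul_comm])
    rw [mulVec_sub, mulVec_sub, mulVec_smul, mulVec_smul, mulVec_smul, mulVec_smul, (hv i).2,
      (hv j).2, ← hij, smul_sub, smul_comm, smul_comm (f (v i))]
  have h1 : star (v i) ⬝ᵥ (massC k h *ᵥ (f (v j) • v i - f (v i) • v j)) = f (v j) := by
    rw [mulVec_sub, mulVec_smul, mulVec_smul, dotProduct_sub, dotProduct_smul, dotProduct_smul,
      ho, ho]
    simp [hne]
  rw [h0, mulVec_zero, dotProduct_zero] at h1
  exact hj h1.symm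

/-! ### Diagonalisation of Hermitian pencils -/

theorem posDef_factor {n : Type*} [Fintype n] [DecidableEq n] {M : Matrix n n ℂ} (hM : M.PosDef) :
    ∃ B : Matrix n n ℂ, IsUnit B.det ∧ M = Bᴴ * B := by
  obtain ⟨B, hB, rfl⟩ := CStarAlgebra.isStrictlyPositive_iff_eq_star_mul_self.mp
    hM.isStrictlyPositive
  exact ⟨B, (isUnit_iff_isUnit_det B).mp hB, rfl⟩

/-- Simultaneous diagonalisation of a Hermitian pencil, with ordered eigenvalues. -/
theorem exists_pencil_eigenbasis {N : ℕ} {K M : Matrix (Fin N) (Fin N) ℂ} (hK : K.IsHermitian)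
    (hM : M.PosDef) : ∃ (σ : Fin N → ℝ) (v : Fin N → Fin N → ℂ), Monotone σ ∧
      (∀ j, K *ᵥ v j = (σ j : ℂ) • (M *ᵥ v j)) ∧
      ∀ i j, star (v i) ⬝ᵥ (M *ᵥ v j) = if i = j then 1 else 0 := by
  obtain ⟨B, hB, rfl⟩ := posDef_factor hM
  have hBH : IsUnit Bᴴ.det := by rw [det_conjTranspose]; exact hB.star
  -- With M = B*B, the substitution v = B⁻¹w turns the pencil into an ordinary Hermitian eigenvalue
  -- problem.
  have hA : ((B⁻¹)ᴴ * K * B⁻¹).IsHermitian := isHermitian_conjTranspose_mul_mul _ hK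
  set w : Fin N → Fin N → ℂ := fun j => ⇑(hA.eigenvectorBasis j)
  have hw : ∀ j, K *ᵥ (B⁻¹ *ᵥ w j) = (hA.eigenvalues j : ℂ) • (Bᴴ *ᵥ w j) := by
    intro j
    have h1 := congrArg (fun x => Bᴴ *ᵥ x) (hA.mulVec_eigenvectorBasis j)
    simp only [mulVec_smul] at h1
    rw [← mulVec_mulVec, ← mulVec_mulVec, mulVec_mulVec _ Bᴴ, show Bᴴ * (B⁻¹)ᴴ = 1 by
      rw [conjTranspose_nonsing_inv, Matrix.mul_nonsing_inv _ hBH], one_mulVec] at h1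
    exact h1
  have hBw : ∀ j, (Bᴴ * B) *ᵥ (B⁻¹ *ᵥ w j) = Bᴴ *ᵥ w j := by
    intro j
    rw [mulVec_mulVec, Matrix.mul_assoc, Matrix.mul_nonsing_inv _ hB, Matrix.mul_one]
  have ho : ∀ i j, star (B⁻¹ *ᵥ w i) ⬝ᵥ ((Bᴴ * B) *ᵥ (B⁻¹ *ᵥ w j)) = if i = j then 1 else 0 := by
    intro i j
    have h1 := orthonormal_iff_ite.mp hA.eigenvectorBasis.orthonormal i j
    rw [EuclideanSpace.inner_eq_star_dotProduct, dotProduct_comm] at h1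
    rw [hBw, star_mulVec, ← dotProduct_mulVec, mulVec_mulVec, conjTranspose_nonsing_inv,
      Matrix.nonsing_inv_mul _ hBH, one_mulVec]
    exact h1
  refine ⟨hA.eigenvalues ∘ Tuple.sort hA.eigenvalues,
    fun j => B⁻¹ *ᵥ w (Tuple.sort hA.eigenvalues j), Tuple.monotone_sort _, fun j => ?_,
    fun i j => ?_⟩
  · rw [hBw]; exact hw _
  · rw [ho]; simp

/-- The characteristic determinant of a pencil in terms of an eigenbasis. -/
theorem det_pencil {N : ℕ} {K M : Matrix (Fin N) (Fin N) ℂ} {σ : Fin N → ℝ}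
    {v : Fin N → Fin N → ℂ} (hv : ∀ j, K *ᵥ v j = (σ j : ℂ) • (M *ᵥ v j))
    (ho : ∀ i j, star (v i) ⬝ᵥ (M *ᵥ v j) = if i = j then 1 else 0) (s : ℝ) :
    (K - (s : ℂ) • M).det = M.det * ((∏ j, (σ j - s) : ℝ) : ℂ) := by
  set V : Matrix (Fin N) (Fin N) ℂ := Matrix.of fun a j => v j a
  have hent : ∀ (A : Matrix (Fin N) (Fin N) ℂ) i j, (Vᴴ * (A * V)) i j = star (v i) ⬝ᵥ (A *ᵥ v j) :=
    fun A i j => rfl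
  -- V diagonalises both forms at once; comparing the two determinants eliminates those of V and its
  -- adjoint.
  have h1 : Vᴴ * (M * V) = 1 := by
    ext i j; rw [hent, ho, one_apply]
  have h2 : Vᴴ * ((K - (s : ℂ) • M) * V) = diagonal fun j => ((σ j - s : ℝ) : ℂ) := by
    ext i j
    rw [hent, sub_mulVec, hv, smul_mulVec, dotProduct_sub, dotProduct_smul, dotProduct_smul, ho,
      diagonal_apply]
    split_ifs with hij
    · subst hij; simp
    · simp
  have d1 := congrArg det h1
  have d2 := congrArg det h2
  rw [det_mul, det_mul, det_one] at d1
  rw [det_mul, det_mul, det_diagonal] at d2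
  push_cast at d2 ⊢
  rw [← d2]
  linear_combination (-(K - (s : ℂ) • M).det) * d1

/-- Both are the increasing enumeration of the same N-element set. -/
theorem strictMono_unique {N : ℕ} {f g : Fin N → ℝ} (hf : StrictMono f) (hg : StrictMono g)
    (hfg : ∀ i, ∃ j, g j = f i) : f = g := by
  have hcard : (Finset.univ.image g).card = N := by
    rw [Finset.card_image_of_injective _ hg.injective]; simp
  exact (Finset.orderEmbOfFin_unique hcard (f := f) (fun i => by simpa using hfg i) hf).trans
    (Finset.orderEmbOfFin_unique hcard (f := g) (fun i => by simp) hg).symm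

/-! ### The characteristic function and its symmetries -/

/-- The characteristic function `det(𝒦(ξ) - sM)`, which is real. -/
noncomputable def charFn (k : ℕ) (h : ℝ) (p : ℝ × ℝ) : ℝ :=
  (symbol k h p.1 - (p.2 : ℂ) • massC k h).det.re

theorem contDiff_charFn (k : ℕ) (h : ℝ) : ContDiff ℝ ω (charFn k h) := by
  unfold charFn
  refine Complex.reCLM.contDiff.comp ?_
  have he : ∀ i j, ContDiff ℝ ω
      fun p : ℝ × ℝ => (symbol k h p.1 - (p.2 : ℂ) • massC k h) i j := by
    intro i j
    simp only [symbol, Matrix.sub_apply, Matrix.add_apply, Matrix.smul_apply, map_apply,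
      smul_eq_mul]
    have h1 : ContDiff ℝ ω fun p : ℝ × ℝ => Complex.I * ((p.1 * h : ℝ) : ℂ) :=
      contDiff_const.mul (Complex.ofRealCLM.contDiff.comp (contDiff_fst.mul contDiff_const))
    have h2 : ContDiff ℝ ω fun p : ℝ × ℝ => (p.2 : ℂ) :=
      Complex.ofRealCLM.contDiff.comp contDiff_snd
    have h3 : ContDiff ℝ ω Complex.exp := Complex.contDiff_exp
    exact ((contDiff_const.add ((h3.comp h1.neg).mul contDiff_const)).add
      ((h3.comp h1).mul contDiff_const)).sub (h2.mul contDiff_const)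
  simp only [det_apply]
  exact ContDiff.sum fun σ _ => (contDiff_prod fun i _ => he _ _).const_smul _

theorem phase_neg (h ξ : ℝ) : phase h (-ξ) = starRingEnd ℂ (phase h ξ) := by
  rw [conj_phase, phase]; simp

theorem symbol_neg (k : ℕ) (h ξ : ℝ) :
    symbol k h (-ξ) = (symbol k h ξ).map (starRingEnd ℂ) := by
  ext i j
  have h1 := conj_phase h ξ
  have h2 := conj_phase h (-ξ)
  have h3 := phase_neg h ξ
  rw [h3, Complex.conj_conj] at h2
  unfold phase at h1 h2 h3
  simp only [symbol, Matrix.add_apply, Matrix.smul_apply, map_apply, smul_eq_mul, map_add, map_mul,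
    Complex.conj_ofReal, h1, h3, ← h2, ← Complex.exp_conj]
  simp

theorem charFn_neg (k : ℕ) (h ξ s : ℝ) : charFn k h (-ξ, s) = charFn k h (ξ, s) := by
  have : symbol k h (-ξ) - (s : ℂ) • massC k h
      = (starRingEnd ℂ).mapMatrix (symbol k h ξ - (s : ℂ) • massC k h) := by
    ext i j
    simp [symbol_neg, massC]
  simp only [charFn]
  rw [this, ← RingHom.map_det, Complex.conj_re]

theorem symbol_periodic (k : ℕ) {h : ℝ} (hh : 0 < h) (ξ : ℝ) :
    symbol k h (ξ + 2 * (Real.pi / h)) = symbol k h ξ := by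
  have e : (ξ + 2 * (Real.pi / h)) * h = ξ * h + 2 * Real.pi := by field_simp
  have h1 : Complex.exp (Complex.I * ((ξ * h + 2 * Real.pi : ℝ) : ℂ))
      = Complex.exp (Complex.I * (ξ * h : ℝ)) := by
    rw [← Complex.exp_periodic (Complex.I * (ξ * h : ℝ))]; congr 1; push_cast; ring
  simp only [symbol, e, Complex.exp_neg, h1]

theorem charFn_periodic (k : ℕ) {h : ℝ} (hh : 0 < h) (ξ s : ℝ) :
    charFn k h (ξ + 2 * (Real.pi / h), s) = charFn k h (ξ, s) := by
  simp only [charFn, symbol_periodic k hh]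

/-- Evenness, which comes from the blocks being real, combines with the period 2π/h to give a
reflection about each of the three points. -/
theorem charFn_reflect {k : ℕ} {h : ℝ} (hh : 0 < h) {ξ₀ : ℝ}
    (h0 : ξ₀ = 0 ∨ ξ₀ = Real.pi / h ∨ ξ₀ = -(Real.pi / h)) (t s : ℝ) :
    charFn k h (ξ₀ - t, s) = charFn k h (ξ₀ + t, s) := by
  rw [← charFn_neg, neg_sub]
  rcases h0 with rfl | rfl | rfl
  · simp
  · rw [← charFn_periodic k hh (t - _)]
    congr 2; ring
  · rw [← charFn_periodic k hh (-_ + t)]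
    congr 2; ring

section Eigenbasis

variable {k : ℕ} {h ξ : ℝ} {σ : Fin (k + 1) → ℝ} {v : Fin (k + 1) → Fin (k + 1) → ℂ}

theorem massC_det_re_pos (hh : 0 < h) : 0 < (massC k h).det.re ∧ (massC k h).det.im = 0 := by
  have := (massC_posDef (k := k) hh).det_pos
  rw [Complex.lt_def] at this
  exact ⟨this.1, this.2.symm⟩

theorem charFn_eq (hv : ∀ j, IsEigenpair k h ξ (σ j) (v j))
    (ho : ∀ i j, star (v i) ⬝ᵥ (massC k h *ᵥ v j) = if i = j then 1 else 0) (s : ℝ) :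
    charFn k h (ξ, s) = (massC k h).det.re * ∏ j, (σ j - s) := by
  simp only [charFn]
  rw [det_pencil (fun j => (hv j).2) ho, Complex.re_mul_ofReal]

theorem charFn_self (hv : ∀ j, IsEigenpair k h ξ (σ j) (v j))
    (ho : ∀ i j, star (v i) ⬝ᵥ (massC k h *ᵥ v j) = if i = j then 1 else 0) (j : Fin (k + 1)) :
    charFn k h (ξ, σ j) = 0 := by
  rw [charFn_eq hv ho, Finset.prod_eq_zero (Finset.mem_univ j) (sub_self _), mul_zero]

theorem exists_eq_of_charFn_eq_zero (hh : 0 < h) (hv : ∀ j, IsEigenpair k h ξ (σ j) (v j))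
    (ho : ∀ i j, star (v i) ⬝ᵥ (massC k h *ᵥ v j) = if i = j then 1 else 0) {s : ℝ}
    (hs : charFn k h (ξ, s) = 0) : ∃ j, σ j = s := by
  rw [charFn_eq hv ho, mul_eq_zero] at hs
  obtain ⟨j, -, hj⟩ := Finset.prod_eq_zero_iff.mp
    (hs.resolve_left (massC_det_re_pos hh).1.ne')
  exact ⟨j, sub_eq_zero.mp hj⟩

/-- Up to sign the s-derivative is det M times the product of the gaps to the other eigenvalues, all
nonzero by simplicity. -/
theorem fderiv_charFn_ne_zero (hh : 0 < h) (hv : ∀ j, IsEigenpair k h ξ (σ j) (v j))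
    (ho : ∀ i j, star (v i) ⬝ᵥ (massC k h *ᵥ v j) = if i = j then 1 else 0) (i : Fin (k + 1)) :
    fderiv ℝ (charFn k h) (ξ, σ i) (0, 1) ≠ 0 := by
  have hd : HasFDerivAt (charFn k h) (fderiv ℝ (charFn k h) (ξ, σ i)) (ξ, σ i) :=
    ((contDiff_charFn k h).differentiable (by simp)).differentiableAt.hasFDerivAt
  have h1 : HasDerivAt (fun s : ℝ => charFn k h (ξ, s))
      (fderiv ℝ (charFn k h) (ξ, σ i) (0, 1)) (σ i) :=
    hd.comp_hasDerivAt (σ i) ((hasDerivAt_const (σ i) ξ).prodMk (hasDerivAt_id (σ i)))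
  set g : ℝ → ℝ := fun s => (massC k h).det.re * ∏ j ∈ Finset.univ.erase i, (σ j - s) with hg
  have hgd : Differentiable ℝ g := by
    refine (differentiable_const _).mul ?_
    exact Differentiable.fun_finsetProd fun j _ => (differentiable_const _).sub differentiable_id
  have h2 : HasDerivAt (fun s : ℝ => charFn k h (ξ, s)) (-g (σ i)) (σ i) := by
    have : (fun s : ℝ => charFn k h (ξ, s)) = fun s => (σ i - s) * g s := by
      ext s
      rw [charFn_eq hv ho, ← Finset.mul_prod_erase _ _ (Finset.mem_univ i), hg]
      ring
    rw [this]
    have h3 := ((hasDerivAt_id (σ i)).const_sub (σ i)).mul (hgd (σ i)).hasDerivAt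
    refine h3.congr_deriv ?_
    simp
  rw [h1.unique h2, neg_ne_zero, hg]
  refine mul_ne_zero (massC_det_re_pos hh).1.ne' (Finset.prod_ne_zero_iff.mpr fun j hj => ?_)
  rw [sub_ne_zero]
  exact (eigenvalue_injective hh hv ho).ne (Finset.ne_of_mem_erase hj)

end Eigenbasis

/-! ### Existence of analytic branches -/

theorem exists_sorted_eigenbasis (k : ℕ) {h : ℝ} (hh : 0 < h) (ξ : ℝ) :
    ∃ (σ : Fin (k + 1) → ℝ) (v : Fin (k + 1) → Fin (k + 1) → ℂ), StrictMono σ ∧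
      (∀ j, IsEigenpair k h ξ (σ j) (v j)) ∧
      ∀ i j, star (v i) ⬝ᵥ (massC k h *ᵥ v j) = if i = j then 1 else 0 := by
  obtain ⟨σ, v, hmono, hv, ho⟩ :=
    exists_pencil_eigenbasis (symbol_isHermitian (k := k) hh ξ) (massC_posDef hh)
  have hv' : ∀ j, IsEigenpair k h ξ (σ j) (v j) := fun j => by
    refine ⟨fun h0 => ?_, hv j⟩
    have := ho j j
    rw [h0] at this
    simp at this
  exact ⟨σ, v, hmono.strictMono_of_injective (eigenvalue_injective hh hv' ho), hv', ho⟩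

/-- The eigenvalues of the symbol in increasing order. -/
noncomputable def sortedEigenvalue (k : ℕ) {h : ℝ} (hh : 0 < h) (j : Fin (k + 1)) (ξ : ℝ) : ℝ :=
  (exists_sorted_eigenbasis k hh ξ).choose j

theorem sortedEigenvalue_spec (k : ℕ) {h : ℝ} (hh : 0 < h) (ξ : ℝ) :
    ∃ v : Fin (k + 1) → Fin (k + 1) → ℂ, StrictMono (fun j => sortedEigenvalue k hh j ξ) ∧
      (∀ j, IsEigenpair k h ξ (sortedEigenvalue k hh j ξ) (v j)) ∧
      ∀ i j, star (v i) ⬝ᵥ (massC k h *ᵥ v j) = if i = j then 1 else 0 :=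
  (exists_sorted_eigenbasis k hh ξ).choose_spec

/-- The implicit function theorem yields k + 1 analytic root functions near ξ₀. By continuity they
keep their strict order, so they are the ordered eigenvalues. -/
theorem analyticAt_sortedEigenvalue (k : ℕ) {h : ℝ} (hh : 0 < h) (j : Fin (k + 1)) (ξ₀ : ℝ) :
    AnalyticAt ℝ (sortedEigenvalue k hh j) ξ₀ := by
  obtain ⟨v, hmono, hv, ho⟩ := sortedEigenvalue_spec k hh ξ₀
  have hlocal : ∀ i : Fin (k + 1), ∃ φ : ℝ → ℝ, ContDiffAt ℝ ω φ ξ₀ ∧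
      φ ξ₀ = sortedEigenvalue k hh i ξ₀ ∧ ∀ᶠ ξ in 𝓝 ξ₀, charFn k h (ξ, φ ξ) = 0 := by
    intro i
    have cd : ContDiffAt ℝ ω (charFn k h) (ξ₀, sortedEigenvalue k hh i ξ₀) :=
      (contDiff_charFn k h).contDiffAt
    have hinv : (fderiv ℝ (charFn k h) (ξ₀, sortedEigenvalue k hh i ξ₀) ∘L
        .inr ℝ ℝ ℝ).IsInvertible := by
      have hne := fderiv_charFn_ne_zero hh hv ho i
      refine ⟨ContinuousLinearEquiv.unitsEquivAut ℝ (Units.mk0 _ hne), ?_⟩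
      ext
      simp
    refine ⟨cd.implicitFunction (by simp) hinv, cd.contDiffAt_implicitFunction (by simp) hinv,
      cd.implicitFunction_apply_self (by simp) hinv, ?_⟩
    filter_upwards [cd.eventually_apply_implicitFunction (by simp) hinv] with ξ hξ
    rw [hξ, charFn_self hv ho]
  choose φ hφ hφ0 hφroot using hlocal
  have hlt : ∀ᶠ ξ in 𝓝 ξ₀, ∀ a b : Fin (k + 1), a < b → φ a ξ < φ b ξ := by
    refine eventually_all.mpr fun a => eventually_all.mpr fun b => ?_
    by_cases hab : a < b
    · have := (hφ a).continuousAt.eventually_lt (hφ b).continuousAt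
        (by rw [hφ0, hφ0]; exact hmono hab)
      filter_upwards [this] with ξ hξ _ using hξ
    · exact Eventually.of_forall fun _ h' => absurd h' hab
  have heq : ∀ᶠ ξ in 𝓝 ξ₀, φ j ξ = sortedEigenvalue k hh j ξ := by
    filter_upwards [hlt, eventually_all.mpr hφroot] with ξ h1 h2
    obtain ⟨w, hm, hw, hwo⟩ := sortedEigenvalue_spec k hh ξ
    exact congrFun (strictMono_unique (f := fun i => φ i ξ) (fun a b hab => h1 a b hab) hm
      fun i => exists_eq_of_charFn_eq_zero hh hw hwo (h2 i)) j
  exact (hφ j).analyticAt.congr heq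

theorem phase_zero (h : ℝ) : phase h 0 = 1 := by simp [phase]

/-- At zero frequency the constants are eigenvectors with eigenvalue zero. -/
theorem exists_eigenpair_zero (k : ℕ) {h : ℝ} (hh : 0 < h) :
    ∃ u : Fin (k + 1) → ℂ, IsEigenpair k h 0 0 u := by
  obtain ⟨u, hu⟩ := exists_polyOf_eq (k := k) (p := C 1) (by simp)
  have hG : gradC k h 0 *ᵥ u = 0 := by
    refine dotProduct_eq_zero _ fun w => ?_
    rw [dotProduct_comm, gradC_inner hh, hu]
    simp [gradForm, phase_zero]
  refine ⟨u, fun h0 => ?_, ?_⟩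
  · rw [h0, map_zero] at hu
    exact one_ne_zero (C_eq_zero.mp hu.symm)
  · rw [symbol_eq hh, ← mulVec_mulVec, hG]
    simp

theorem exists_modeFamily (k : ℕ) {h : ℝ} (hh : 0 < h) :
    ∃ (σ : Fin (k + 1) → ℝ → ℝ) (ph : Fin (k + 1)), IsModeFamily k h σ ph := by
  obtain ⟨v, hm, hv, ho⟩ := sortedEigenvalue_spec k hh 0
  obtain ⟨u, hu⟩ := exists_eigenpair_zero k hh
  have hdet : charFn k h (0, 0) = 0 := by
    have : (symbol k h 0 - ((0 : ℝ) : ℂ) • massC k h).det = 0 :=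
      exists_mulVec_eq_zero_iff.mp ⟨u, hu.1, by simp [hu.2]⟩
    simp only [charFn]
    rw [this, Complex.zero_re]
  obtain ⟨ph, hph⟩ := exists_eq_of_charFn_eq_zero hh hv ho hdet
  refine ⟨sortedEigenvalue k hh, ph, fun j => ?_, fun ξ _ => ?_, hph⟩
  · exact fun ξ _ => (analyticAt_sortedEigenvalue k hh j ξ).analyticWithinAt
  · obtain ⟨w, -, hw, hwo⟩ := sortedEigenvalue_spec k hh ξ
    exact ⟨w, hw, hwo⟩

/-! ### The frequency domain and the limit points -/

theorem norm_one_sub_phase_sq (h ξ : ℝ) :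
    ‖1 - phase h ξ‖ ^ 2 = (2 * Real.sin (ξ * h / 2)) ^ 2 := by
  have hz : phase h ξ = Complex.exp (((-(ξ * h) : ℝ) : ℂ) * Complex.I) := by
    rw [phase]; congr 1; push_cast; ring
  have hcos := Real.cos_two_mul (ξ * h / 2)
  rw [mul_div_cancel₀ _ two_ne_zero] at hcos
  have h1 := Real.sin_sq_add_cos_sq (ξ * h / 2)
  have h2 := Real.sin_sq_add_cos_sq (ξ * h)
  rw [← Complex.normSq_eq_norm_sq, hz, Complex.exp_mul_I, ← Complex.ofReal_cos,
    ← Complex.ofReal_sin, Complex.normSq_apply]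
  simp only [Complex.sub_re, Complex.one_re, Complex.add_re, Complex.ofReal_re, Complex.mul_re,
    Complex.I_re, mul_zero, Complex.ofReal_im, Complex.I_im, mul_one, sub_self, add_zero,
    Complex.sub_im, Complex.one_im, Complex.add_im, Complex.mul_im, zero_add, zero_sub,
    Real.cos_neg, Real.sin_neg]
  nlinarith

theorem phase_ne_one {h ξ : ℝ} (hh : 0 < h) (hξ : ξ ∈ freqDomain h) (h0 : ξ ≠ 0) :
    phase h ξ ≠ 1 := by
  intro h1
  have h2 := norm_one_sub_phase_sq h ξ
  have hl : -Real.pi ≤ ξ * h := by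
    have := mul_le_mul_of_nonneg_right hξ.1 hh.le
    rwa [neg_mul, div_mul_cancel₀ _ hh.ne'] at this
  have hr : ξ * h ≤ Real.pi := by
    have := mul_le_mul_of_nonneg_right hξ.2 hh.le
    rwa [div_mul_cancel₀ _ hh.ne'] at this
  have hpi := Real.pi_pos
  rw [h1, sub_self, norm_zero, eq_comm, zero_pow two_ne_zero, sq_eq_zero_iff, mul_eq_zero] at h2
  have h3 := (Real.sin_eq_zero_iff_of_lt_of_lt (by linarith) (by linarith)).mp
    (h2.resolve_left two_ne_zero)
  have h4 : ξ * h ≠ 0 := mul_ne_zero h0 hh.ne'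
  exact h4 (by linarith)

theorem pi_div_pos {h : ℝ} (hh : 0 < h) : 0 < Real.pi / h := div_pos Real.pi_pos hh

theorem zero_mem_freqDomain {h : ℝ} (hh : 0 < h) : (0 : ℝ) ∈ freqDomain h :=
  ⟨by linarith [pi_div_pos hh], (pi_div_pos hh).le⟩

theorem right_mem_freqDomain {h : ℝ} (hh : 0 < h) : Real.pi / h ∈ freqDomain h :=
  ⟨by linarith [pi_div_pos hh], le_rfl⟩

theorem left_mem_freqDomain {h : ℝ} (hh : 0 < h) : -(Real.pi / h) ∈ freqDomain h :=
  ⟨le_rfl, by linarith [pi_div_pos hh]⟩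

/-- A one-sided or punctured limit filter at one of the frequencies `0`, `±π/h`. -/
structure IsLimitFilter (h : ℝ) (l : Filter ℝ) (ξ₀ : ℝ) : Prop where
  base : ξ₀ = 0 ∨ ξ₀ = Real.pi / h ∨ ξ₀ = -(Real.pi / h)
  le_nhds : l ≤ 𝓝 ξ₀
  mem_Ioo : ∀ᶠ ξ in l, ξ ∈ Set.Ioo (-(Real.pi / h)) (Real.pi / h)
  ne_zero : ∀ᶠ ξ in l, ξ ≠ 0

namespace IsLimitFilter

variable {h : ℝ}

theorem punctured (hh : 0 < h) : IsLimitFilter h (𝓝[≠] 0) 0 where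
  base := Or.inl rfl
  le_nhds := nhdsWithin_le_nhds
  mem_Ioo := nhdsWithin_le_nhds
    (Ioo_mem_nhds (by linarith [pi_div_pos hh]) (pi_div_pos hh))
  ne_zero := self_mem_nhdsWithin

theorem mono {l l' : Filter ℝ} {ξ₀ : ℝ} (hl : IsLimitFilter h l ξ₀) (hle : l' ≤ l) :
    IsLimitFilter h l' ξ₀ where
  base := hl.base
  le_nhds := hle.trans hl.le_nhds
  mem_Ioo := hle hl.mem_Ioo
  ne_zero := hle hl.ne_zero

theorem right (hh : 0 < h) : IsLimitFilter h (𝓝[<] (Real.pi / h)) (Real.pi / h) where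
  base := Or.inr (Or.inl rfl)
  le_nhds := nhdsWithin_le_nhds
  mem_Ioo := Ioo_mem_nhdsLT (by linarith [pi_div_pos hh])
  ne_zero := nhdsWithin_le_nhds (isOpen_ne.mem_nhds (pi_div_pos hh).ne')

theorem left (hh : 0 < h) : IsLimitFilter h (𝓝[>] (-(Real.pi / h))) (-(Real.pi / h)) where
  base := Or.inr (Or.inr rfl)
  le_nhds := nhdsWithin_le_nhds
  mem_Ioo := Ioo_mem_nhdsGT (by linarith [pi_div_pos hh])
  ne_zero := nhdsWithin_le_nhds (isOpen_ne.mem_nhds (neg_ne_zero.mpr (pi_div_pos hh).ne'))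

theorem of_mem (hh : 0 < h) {l : Filter ℝ}
    (hl : l = 𝓝[>] 0 ∨ l = 𝓝[<] 0 ∨ l = 𝓝[<] (Real.pi / h) ∨ l = 𝓝[>] (-(Real.pi / h))) :
    ∃ ξ₀, IsLimitFilter h l ξ₀ := by
  rcases hl with rfl | rfl | rfl | rfl
  · exact ⟨0, (punctured hh).mono (nhdsWithin_mono _ fun _ hx => ne_of_gt hx)⟩
  · exact ⟨0, (punctured hh).mono (nhdsWithin_mono _ fun _ hx => ne_of_lt hx)⟩
  · exact ⟨_, right hh⟩
  · exact ⟨_, left hh⟩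

theorem mem_freqDomain (hh : 0 < h) {l : Filter ℝ} {ξ₀ : ℝ} (hl : IsLimitFilter h l ξ₀) :
    ξ₀ ∈ freqDomain h := by
  rcases hl.base with rfl | rfl | rfl
  exacts [zero_mem_freqDomain hh, right_mem_freqDomain hh, left_mem_freqDomain hh]

theorem le_nhdsWithin {l : Filter ℝ} {ξ₀ : ℝ} (hl : IsLimitFilter h l ξ₀) :
    l ≤ 𝓝[freqDomain h] ξ₀ :=
  le_inf hl.le_nhds (le_principal_iff.mpr (hl.mem_Ioo.mono fun _ hx => Set.Ioo_subset_Icc_self hx))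

end IsLimitFilter

/-! ### Positivity, stationarity and ordering of the branches -/

namespace IsModeFamily

variable {k : ℕ} {h : ℝ} {σ : Fin (k + 1) → ℝ → ℝ} {ph : Fin (k + 1)}

theorem contDiffOn (hσ : IsModeFamily k h σ ph) (j : Fin (k + 1)) :
    ContDiffOn ℝ ω (σ j) (freqDomain h) :=
  (hσ.analytic j).contDiffOn_of_completeSpace

theorem injective (hσ : IsModeFamily k h σ ph) (hh : 0 < h) {ξ : ℝ} (hξ : ξ ∈ freqDomain h) :
    Function.Injective fun j => σ j ξ := by
  obtain ⟨v, hv, ho⟩ := hσ.eigenbasis ξ hξ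
  exact eigenvalue_injective hh hv ho

theorem nonneg (hσ : IsModeFamily k h σ ph) (hh : 0 < h) {ξ : ℝ} (hξ : ξ ∈ freqDomain h)
    (j : Fin (k + 1)) : 0 ≤ σ j ξ := by
  obtain ⟨v, hv, -⟩ := hσ.eigenbasis ξ hξ
  exact (hv j).nonneg hh

/-- A zero eigenvalue forces z = 1, which in this domain happens only at ξ = 0. -/
theorem pos_of_ne_zero (hσ : IsModeFamily k h σ ph) (hh : 0 < h) {ξ : ℝ} (hξ : ξ ∈ freqDomain h)
    (h0 : ξ ≠ 0) (j : Fin (k + 1)) : 0 < σ j ξ := by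
  refine lt_of_le_of_ne (hσ.nonneg hh hξ j) fun hz => ?_
  obtain ⟨v, hv, -⟩ := hσ.eigenbasis ξ hξ
  have := hv j
  rw [← hz] at this
  exact phase_ne_one hh hξ h0 (this.phase_eq_one hh)

theorem pos_of_ne (hσ : IsModeFamily k h σ ph) (hh : 0 < h) {ξ : ℝ} (hξ : ξ ∈ freqDomain h)
    {j : Fin (k + 1)} (hj : j ≠ ph) : 0 < σ j ξ := by
  rcases eq_or_ne ξ 0 with rfl | h0
  · refine lt_of_le_of_ne (hσ.nonneg hh hξ j) fun hz => hj (hσ.injective hh hξ ?_)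
    exact hz.symm.trans hσ.physical.symm
  · exact hσ.pos_of_ne_zero hh hξ h0 j

theorem le_of_stable (hσ : IsModeFamily k h σ ph) {Δt : ℝ} (hst : Stable k h Δt) {ξ : ℝ}
    (hξ : ξ ∈ freqDomain h) (j : Fin (k + 1)) : σ j ξ ≤ 4 / Δt ^ 2 := by
  obtain ⟨v, hv, -⟩ := hσ.eigenbasis ξ hξ
  exact hst ξ hξ _ _ (hv j)

theorem uniqueDiffOn_freqDomain (hh : 0 < h) : UniqueDiffOn ℝ (freqDomain h) :=
  uniqueDiffOn_Icc (by linarith [pi_div_pos hh])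

/-- Dispersion branches are stationary at the frequencies fixed by the reflection symmetry. -/
theorem derivWithin_eq_zero (hσ : IsModeFamily k h σ ph) (hh : 0 < h) (j : Fin (k + 1)) {ξ₀ : ℝ}
    (hbase : ξ₀ = 0 ∨ ξ₀ = Real.pi / h ∨ ξ₀ = -(Real.pi / h)) (hmem : ξ₀ ∈ freqDomain h) :
    derivWithin (σ j) (freqDomain h) ξ₀ = 0 := by
  set d := derivWithin (σ j) (freqDomain h) ξ₀
  have hd : HasDerivWithinAt (σ j) d (freqDomain h) ξ₀ :=
    ((hσ.contDiffOn j).differentiableOn (by simp) ξ₀ hmem).hasDerivWithinAt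
  set L := fderiv ℝ (charFn k h) (ξ₀, σ j ξ₀)
  have hL : HasFDerivAt (charFn k h) L (ξ₀, σ j ξ₀) :=
    ((contDiff_charFn k h).differentiable (by simp)).differentiableAt.hasFDerivAt
  have h1 : HasDerivWithinAt (fun ξ => charFn k h (ξ, σ j ξ)) (L (1, d)) (freqDomain h) ξ₀ :=
    HasFDerivAt.comp_hasDerivWithinAt (f := fun ξ => (ξ, σ j ξ)) ξ₀ hL ((hasDerivWithinAt_id ξ₀ _).prodMk hd)
  have h2 : HasDerivWithinAt (fun ξ => charFn k h (ξ, σ j ξ)) 0 (freqDomain h) ξ₀ := by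
    have hz : ∀ ξ ∈ freqDomain h, charFn k h (ξ, σ j ξ) = 0 := fun ξ hξ => by
      obtain ⟨v, hv, ho⟩ := hσ.eigenbasis ξ hξ
      exact charFn_self hv ho j
    exact (hasDerivWithinAt_const ξ₀ _ (0 : ℝ)).congr hz (hz _ hmem)
  have h3 : L (1, d) = 0 := (uniqueDiffOn_freqDomain hh ξ₀ hmem).eq_deriv _ h1 h2
  -- Reflection equates the derivatives along ξ₀ + t and ξ₀ - t, so L(1, 0) = 0. Then L(1, d) = 0
  -- leaves d · L(0, 1) = 0.
  have hL' : HasFDerivAt (charFn k h) L (ξ₀ + 0, σ j ξ₀) := by rwa [add_zero]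
  have hL'' : HasFDerivAt (charFn k h) L (ξ₀ - 0, σ j ξ₀) := by rwa [sub_zero]
  have h4 : HasDerivAt (fun t => charFn k h (ξ₀ + t, σ j ξ₀)) (L (1, 0)) 0 :=
    HasFDerivAt.comp_hasDerivAt (f := fun t => (ξ₀ + t, σ j ξ₀)) (0 : ℝ) hL'
      (((hasDerivAt_id (0 : ℝ)).const_add ξ₀).prodMk (hasDerivAt_const (0 : ℝ) (σ j ξ₀)))
  have h5 : HasDerivAt (fun t => charFn k h (ξ₀ - t, σ j ξ₀)) (L (-1, 0)) 0 :=
    HasFDerivAt.comp_hasDerivAt (f := fun t => (ξ₀ - t, σ j ξ₀)) (0 : ℝ) hL''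
      (((hasDerivAt_id (0 : ℝ)).const_sub ξ₀).prodMk (hasDerivAt_const (0 : ℝ) (σ j ξ₀)))
  simp only [charFn_reflect hh hbase] at h5
  have h6 := h4.unique h5
  have h7 : L (-1, 0) = -L (1, 0) := by rw [← map_neg]; simp
  have h8 : L (1, d) = L (1, 0) + d * L (0, 1) := by
    rw [← smul_eq_mul, ← map_smul, ← map_add]; simp
  obtain ⟨v, hv, ho⟩ := hσ.eigenbasis ξ₀ hmem
  have h9 := fderiv_charFn_ne_zero hh hv ho j
  have h10 : d * L (0, 1) = 0 := by linarith
  exact (mul_eq_zero.mp h10).resolve_right h9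

theorem tendsto (hσ : IsModeFamily k h σ ph) (hh : 0 < h) (j : Fin (k + 1)) {l : Filter ℝ}
    {ξ₀ : ℝ} (hl : IsLimitFilter h l ξ₀) : Tendsto (σ j) l (𝓝 (σ j ξ₀)) :=
  ((hσ.contDiffOn j).continuousOn ξ₀ (hl.mem_freqDomain hh)).mono_left hl.le_nhdsWithin

theorem differentiableAt (hσ : IsModeFamily k h σ ph) (j : Fin (k + 1)) {ξ : ℝ}
    (hξ : ξ ∈ Set.Ioo (-(Real.pi / h)) (Real.pi / h)) : DifferentiableAt ℝ (σ j) ξ :=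
  ((hσ.contDiffOn j).differentiableOn (by simp)).differentiableAt (Icc_mem_nhds hξ.1 hξ.2)

/-- The derivative within the closed domain is continuous up to the ends and agrees with the
ordinary one inside. -/
theorem tendsto_deriv (hσ : IsModeFamily k h σ ph) (hh : 0 < h) (j : Fin (k + 1)) {l : Filter ℝ}
    {ξ₀ : ℝ} (hl : IsLimitFilter h l ξ₀) : Tendsto (deriv (σ j)) l (𝓝 0) := by
  have hmem := hl.mem_freqDomain hh
  have hc := (hσ.contDiffOn j).continuousOn_derivWithin (uniqueDiffOn_freqDomain hh) (by simp) ξ₀ hmem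
  have h1 := hc.mono_left hl.le_nhdsWithin
  rw [hσ.derivWithin_eq_zero hh j hl.base hmem] at h1
  refine h1.congr' ?_
  filter_upwards [hl.mem_Ioo] with ξ hξ
  exact derivWithin_of_mem_nhds (Icc_mem_nhds hξ.1 hξ.2)

/-- The physical branch stays below every other branch. -/
theorem physical_lt (hσ : IsModeFamily k h σ ph) (hh : 0 < h) {j : Fin (k + 1)} (hj : j ≠ ph)
    {ξ : ℝ} (hξ : ξ ∈ freqDomain h) : σ ph ξ < σ j ξ := by
  by_contra! hle
  have h0 : σ ph 0 ≤ σ j 0 := by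
    rw [hσ.physical]; exact hσ.nonneg hh (zero_mem_freqDomain hh) j
  -- A change of order between 0 and ξ would force a crossing, against simplicity.
  obtain ⟨c, hc, hcc⟩ := (isPreconnected_Icc : IsPreconnected (freqDomain h)).intermediate_value₂
    (zero_mem_freqDomain hh) hξ (hσ.contDiffOn ph).continuousOn (hσ.contDiffOn j).continuousOn
    h0 hle
  exact hj (hσ.injective hh hc hcc).symm

end IsModeFamily

/-! ### From branches to group velocities -/

section GroupVelocity

variable {Δt : ℝ} {σ : ℝ → ℝ}

theorem hasDerivAt_temporalFreq (hΔt : 0 < Δt) {ξ d : ℝ} (hξ : ξ ≠ 0) (hd : HasDerivAt σ d ξ)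
    (h0 : 0 < σ ξ) (h1 : σ ξ < 4 / Δt ^ 2) :
    HasDerivAt (temporalFreq Δt σ)
      (Real.sign ξ * (d / (2 * √(σ ξ)) / √(1 - (√(σ ξ) * Δt / 2) ^ 2))) ξ := by
  have hs : √(σ ξ) * Δt / 2 < 1 := by
    have : √(σ ξ) < 2 / Δt := by
      rw [Real.sqrt_lt' (by positivity), div_pow]; norm_num; exact h1
    rw [lt_div_iff₀ hΔt] at this
    linarith
  have hs' : 0 < √(σ ξ) * Δt / 2 := by
    have := Real.sqrt_pos.mpr h0; positivity
  have h2 : HasDerivAt (fun x => Real.sign ξ * (2 / Δt) * Real.arcsin (√(σ x) * Δt / 2))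
      (Real.sign ξ * (2 / Δt) *
        (1 / √(1 - (√(σ ξ) * Δt / 2) ^ 2) * (d / (2 * √(σ ξ)) * Δt / 2))) ξ :=
    ((Real.hasDerivAt_arcsin (by linarith) hs.ne).comp ξ
      (((hd.sqrt h0.ne').mul_const Δt).div_const 2)).const_mul _
  have hsign : ∀ᶠ x in 𝓝 ξ, Real.sign x = Real.sign ξ := by
    rcases lt_or_gt_of_ne hξ with hn | hp
    · filter_upwards [gt_mem_nhds hn] with x hx
      rw [Real.sign_of_neg hx, Real.sign_of_neg hn]
    · filter_upwards [lt_mem_nhds hp] with x hx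
      rw [Real.sign_of_pos hx, Real.sign_of_pos hp]
  refine (h2.congr_of_eventuallyEq ?_).congr_deriv ?_
  · filter_upwards [hsign] with x hx
    rw [temporalFreq, hx]
  · field_simp

theorem abs_sign_eq_one {ξ : ℝ} (hξ : ξ ≠ 0) : |Real.sign ξ| = 1 := by
  rcases Real.sign_apply_eq_of_ne_zero ξ hξ with h | h <;> rw [h] <;> simp

theorem groupVelocityTendsto_zero (hΔt : 0 < Δt) {l : Filter ℝ} {s₀ : ℝ}
    (hs : Tendsto σ l (𝓝 s₀)) (h0 : 0 < s₀) (h1 : s₀ < 4 / Δt ^ 2) (hne : ∀ᶠ ξ in l, ξ ≠ 0)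
    (hdiff : ∀ᶠ ξ in l, DifferentiableAt ℝ σ ξ) (hd : Tendsto (deriv σ) l (𝓝 0)) :
    GroupVelocityTendsto (temporalFreq Δt σ) l 0 := by
  have hev : ∀ᶠ ξ in l, HasDerivAt (temporalFreq Δt σ) (Real.sign ξ *
      (deriv σ ξ / (2 * √(σ ξ)) / √(1 - (√(σ ξ) * Δt / 2) ^ 2))) ξ := by
    filter_upwards [hne, hdiff, hs.eventually_lt_const h1, hs.eventually_const_lt h0]
      with ξ hξ hdξ hlt hgt
    exact hasDerivAt_temporalFreq hΔt hξ hdξ.hasDerivAt hgt hlt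
  refine ⟨hev.mono fun ξ h => h.differentiableAt, ?_⟩
  refine Tendsto.congr' (hev.mono fun ξ h => h.deriv.symm) ?_
  have hr : (√s₀ * Δt / 2) ^ 2 < 1 := by
    rw [div_pow, mul_pow, Real.sq_sqrt h0.le]
    rw [lt_div_iff₀ (by positivity)] at h1
    linarith
  have hlim : Tendsto (fun ξ => deriv σ ξ / (2 * √(σ ξ)) / √(1 - (√(σ ξ) * Δt / 2) ^ 2)) l
      (𝓝 (0 / (2 * √s₀) / √(1 - (√s₀ * Δt / 2) ^ 2))) := by
    refine (hd.div (hs.sqrt.const_mul 2) ?_).div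
      ((tendsto_const_nhds.sub (((hs.sqrt.mul_const Δt).div_const 2).pow 2)).sqrt) ?_
    · have := Real.sqrt_pos.mpr h0; positivity
    · exact (Real.sqrt_pos.mpr (by linarith)).ne'
  rw [zero_div, zero_div] at hlim
  -- The sign need not be constant along l, but it has modulus one, so norms suffice.
  refine squeeze_zero_norm' (hne.mono fun ξ hξ => ?_)
    (tendsto_zero_iff_norm_tendsto_zero.mp hlim)
  rw [norm_mul, Real.norm_eq_abs (Real.sign ξ), abs_sign_eq_one hξ, one_mul]

end GroupVelocity

section GroupVelocity

variable {Δt : ℝ} {σ : ℝ → ℝ}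

theorem tendsto_abs_temporalFreq (hΔt : 0 < Δt) {l : Filter ℝ}
    (hs : Tendsto σ l (𝓝 (4 / Δt ^ 2))) (hne : ∀ᶠ ξ in l, ξ ≠ 0) :
    Tendsto (fun ξ => |temporalFreq Δt σ ξ|) l (𝓝 (Real.pi / Δt)) := by
  have hval : √(4 / Δt ^ 2) * Δt / 2 = 1 := by
    rw [show 4 / Δt ^ 2 = (2 / Δt) ^ 2 by rw [div_pow]; norm_num, Real.sqrt_sq (by positivity)]
    field_simp
  have h1 := (Real.continuous_arcsin.tendsto _).comp ((hs.sqrt.mul_const Δt).div_const 2)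
  rw [hval, Real.arcsin_one] at h1
  have h2 := (h1.const_mul (2 / Δt)).abs
  rw [show 2 / Δt * (Real.pi / 2) = Real.pi / Δt by field_simp,
    abs_of_pos (div_pos Real.pi_pos hΔt)] at h2
  refine h2.congr' (hne.mono fun ξ hξ => ?_)
  simp only [temporalFreq, abs_mul, abs_sign_eq_one hξ, one_mul, Function.comp]

/-- A branch with `σ(ξ) ~ ξ²` at the origin has unit group velocity there. -/
theorem groupVelocityTendsto_one (hΔt : 0 < Δt) (hs : AnalyticAt ℝ σ 0) (h0 : σ 0 = 0)
    (hd0 : deriv σ 0 = 0) (hpos : ∀ᶠ ξ in 𝓝[≠] 0, 0 < σ ξ)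
    (hlim : Tendsto (fun ξ => σ ξ / ξ ^ 2) (𝓝[≠] 0) (𝓝 1)) :
    GroupVelocityTendsto (temporalFreq Δt σ) (𝓝[≠] 0) 1 := by
  have hne : ∀ᶠ ξ : ℝ in 𝓝[≠] 0, ξ ≠ 0 := self_mem_nhdsWithin
  have hdiff : ∀ᶠ ξ in 𝓝[≠] 0, DifferentiableAt ℝ σ ξ :=
    nhdsWithin_le_nhds (hs.eventually_analyticAt.mono fun ξ h => h.differentiableAt)
  have hσ0 : Tendsto σ (𝓝[≠] 0) (𝓝 0) := by
    have := hs.continuousAt.tendsto.mono_left (nhdsWithin_le_nhds (s := {0}ᶜ))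
    rwa [h0] at this
  -- This limit exists as half the second derivative at 0. L'Hôpital then serves in reverse: the
  -- known limit of σ/ξ² identifies b.
  obtain ⟨b, hb⟩ : ∃ b, Tendsto (fun ξ => deriv σ ξ / (2 * ξ)) (𝓝[≠] 0) (𝓝 b) := by
    have h1 := hs.deriv.differentiableAt.hasDerivAt.tendsto_slope_zero
    refine ⟨deriv (deriv σ) 0 / 2, (h1.div_const 2).congr fun ξ => ?_⟩
    simp only [zero_add, hd0, sub_zero, smul_eq_mul]
    field_simp
  have hb1 : b = 1 := by
    refine tendsto_nhds_unique ?_ hlim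
    refine HasDerivAt.lhopital_zero_nhdsNE (f' := deriv σ) (g' := fun ξ => 2 * ξ)
      (hdiff.mono fun ξ h => h.hasDerivAt) (Eventually.of_forall fun ξ => ?_)
      (hne.mono fun ξ h => mul_ne_zero two_ne_zero h) hσ0 ?_ hb
    · simpa using hasDerivAt_pow 2 ξ
    · have : Tendsto (fun ξ : ℝ => ξ ^ 2) (𝓝 0) (𝓝 (0 ^ 2)) := (continuous_pow 2).tendsto 0
      rw [zero_pow two_ne_zero] at this
      exact this.mono_left nhdsWithin_le_nhds
  rw [hb1] at hb
  have hev : ∀ᶠ ξ in 𝓝[≠] 0, HasDerivAt (temporalFreq Δt σ) (Real.sign ξ *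
      (deriv σ ξ / (2 * √(σ ξ)) / √(1 - (√(σ ξ) * Δt / 2) ^ 2))) ξ := by
    filter_upwards [hne, hdiff, hpos, hσ0.eventually_lt_const (by positivity : 0 < 4 / Δt ^ 2)]
      with ξ hξ hdξ hgt hlt
    exact hasDerivAt_temporalFreq hΔt hξ hdξ.hasDerivAt hgt hlt
  refine ⟨hev.mono fun ξ h => h.differentiableAt, ?_⟩
  -- Dividing σ' by ξ and √σ by |ξ| absorbs the sign, since ξ = sign(ξ)|ξ|.
  have hlim2 : Tendsto (fun ξ => deriv σ ξ / (2 * ξ) / √(σ ξ / ξ ^ 2)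
      / √(1 - (√(σ ξ) * Δt / 2) ^ 2)) (𝓝[≠] 0)
      (𝓝 (1 / √1 / √(1 - (√0 * Δt / 2) ^ 2))) := by
    refine (hb.div hlim.sqrt (by simp)).div
      ((tendsto_const_nhds.sub (((hσ0.sqrt.mul_const Δt).div_const 2).pow 2)).sqrt) (by simp)
  simp only [Real.sqrt_one, Real.sqrt_zero, zero_mul, zero_div, ne_eq, OfNat.ofNat_ne_zero,
    not_false_eq_true, zero_pow, sub_zero, div_one] at hlim2
  refine hlim2.congr' ?_
  filter_upwards [hev, hne, hpos] with ξ hξ hξ0 hξp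
  rw [hξ.deriv, Real.sqrt_div hξp.le, Real.sqrt_sq_eq_abs, ← mul_div_assoc]
  congr 1
  have := (Real.sqrt_pos.mpr hξp).ne'
  rcases lt_or_gt_of_ne hξ0 with hn | hp
  · rw [Real.sign_of_neg hn, abs_of_neg hn]; field_simp
  · rw [Real.sign_of_pos hp, abs_of_pos hp]; field_simp

end GroupVelocity

/-! ### Compactness and the physical branch near zero -/

/-- The unit sphere of the mass inner product. -/
def massSphere (k : ℕ) (h : ℝ) : Set (Fin (k + 1) → ℂ) := {x | star x ⬝ᵥ (massC k h *ᵥ x) = 1}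

/-- With M = B*B, it is a closed subset of the image of the unit ball under B⁻¹. -/
theorem isCompact_massSphere (k : ℕ) {h : ℝ} (hh : 0 < h) : IsCompact (massSphere k h) := by
  obtain ⟨B, hB, hMB⟩ := posDef_factor (massC_posDef (k := k) hh)
  have hclosed : IsClosed (massSphere k h) := by
    refine isClosed_eq ?_ continuous_const
    fun_prop
  have hmaps : massSphere k h ⊆ (fun w => B⁻¹ *ᵥ w) '' Metric.closedBall 0 1 := by
    intro x hx
    refine ⟨B *ᵥ x, ?_, ?_⟩
    · rw [mem_closedBall_zero_iff, pi_norm_le_iff_of_nonneg zero_le_one]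
      intro i
      have h1 : star (B *ᵥ x) ⬝ᵥ (B *ᵥ x) = 1 := by
        have : star x ⬝ᵥ (massC k h *ᵥ x) = 1 := hx
        rw [hMB, ← mulVec_mulVec] at this
        rw [star_mulVec, ← dotProduct_mulVec, this]
      have h2 : ∑ i, ‖(B *ᵥ x) i‖ ^ 2 = 1 := by
        have h3 : ((∑ i, ‖(B *ᵥ x) i‖ ^ 2 : ℝ) : ℂ) = 1 := by
          rw [← h1, dotProduct]
          push_cast
          refine Finset.sum_congr rfl fun i _ => ?_
          rw [Pi.star_apply, mul_comm, ← starRingEnd_apply, Complex.mul_conj,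
            Complex.normSq_eq_norm_sq]
          push_cast; rfl
        exact_mod_cast h3
      have h4 : ‖(B *ᵥ x) i‖ ^ 2 ≤ 1 := by
        rw [← h2]
        exact Finset.single_le_sum (f := fun i => ‖(B *ᵥ x) i‖ ^ 2) (fun _ _ => by positivity)
          (Finset.mem_univ i)
      exact (sq_le_one_iff₀ (norm_nonneg _)).mp h4
    · simp only
      rw [mulVec_mulVec, Matrix.nonsing_inv_mul _ hB, one_mulVec]
  exact ((isCompact_closedBall _ _).image (by fun_prop)).of_isClosed_subset hclosed hmaps

/-- Normalised vectors that are asymptotically annihilated by `T ξ` accumulate at the normalised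
vectors in the kernel of `T 0`; a function constant on the latter therefore converges. -/
theorem tendsto_of_asymptotic_kernel {k : ℕ} {h : ℝ} (hh : 0 < h) {l : Filter ℝ} (hl : l ≤ 𝓝 0)
    {T : ℝ → Matrix (Fin (k + 1)) (Fin (k + 1)) ℂ} (hT : Continuous T)
    {x : ℝ → Fin (k + 1) → ℂ} (hx : ∀ᶠ ξ in l, x ξ ∈ massSphere k h)
    (hTx : Tendsto (fun ξ => T ξ *ᵥ x ξ) l (𝓝 0)) {f : (Fin (k + 1) → ℂ) → ℝ} (hf : Continuous f)
    {c : ℝ} (hc : ∀ y ∈ massSphere k h, T 0 *ᵥ y = 0 → f y = c) :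
    Tendsto (fun ξ => f (x ξ)) l (𝓝 c) := by
  -- Along an ultrafilter compactness supplies a limit y of x, although x need not be continuous in
  -- ξ.
  rw [tendsto_iff_ultrafilter]
  intro g hg
  obtain ⟨y, hy, hxy⟩ := (isCompact_massSphere k hh).ultrafilter_le_nhds' (g.map x) (hg hx)
  have hxy' : Tendsto x g (𝓝 y) := hxy
  have hT0 : Tendsto (fun ξ => T ξ *ᵥ x ξ) g (𝓝 (T 0 *ᵥ y)) := by
    have hT' : Tendsto T g (𝓝 (T 0)) := (hT.tendsto 0).mono_left (hg.trans hl)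
    refine tendsto_pi_nhds.mpr fun i => ?_
    simp only [mulVec, dotProduct]
    refine tendsto_finsetSum _ fun j _ => ?_
    exact (tendsto_pi_nhds.mp (tendsto_pi_nhds.mp hT' i) j).mul (tendsto_pi_nhds.mp hxy' j)
  rw [← hc y hy (tendsto_nhds_unique hT0 (hTx.mono_left hg))]
  exact (hf.tendsto y).comp hxy'

theorem tendsto_smul_massC {k : ℕ} {h : ℝ} (hh : 0 < h) {l : Filter ℝ} {r : ℝ → ℂ}
    (hr : Tendsto r l (𝓝 0)) {x : ℝ → Fin (k + 1) → ℂ} (hx : ∀ᶠ ξ in l, x ξ ∈ massSphere k h) :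
    Tendsto (fun ξ => r ξ • (massC k h *ᵥ x ξ)) l (𝓝 0) := by
  have hb : Bornology.IsBounded ((fun y => massC k h *ᵥ y) '' massSphere k h) :=
    ((isCompact_massSphere k hh).image (by fun_prop)).isBounded
  obtain ⟨R, hR⟩ := hb.exists_norm_le
  refine hr.zero_smul_isBoundedUnder_le ⟨R, ?_⟩
  rw [eventually_map]
  filter_upwards [hx] with ξ hξ
  exact hR _ (Set.mem_image_of_mem _ hξ)

theorem refNormSq_C (c : ℂ) : refNormSq (C c) = 2 * ‖c‖ ^ 2 := by
  simp only [refNormSq, eval_C, intervalIntegral.integral_const, smul_eq_mul]; ring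

theorem refInt_C (c : ℂ) : refInt (C c) = 2 * c := by
  simp only [refInt_apply, eval_C, intervalIntegral.integral_const, Complex.real_smul]
  push_cast; ring

theorem mem_massSphere_iff {k : ℕ} {h : ℝ} (hh : 0 < h) (x : Fin (k + 1) → ℂ) :
    x ∈ massSphere k h ↔ h / 2 * refNormSq (polyOf k x) = 1 := by
  rw [massSphere, Set.mem_ofPred_eq, massC_inner hh, polyOf_star, mul_comm (conjPoly _),
    refInt_mul_conj_self]
  norm_cast

theorem continuous_phase (h : ℝ) : Continuous (phase h) := by
  unfold phase; fun_prop

theorem polyOf_eq_C_of_gradC {k : ℕ} {h : ℝ} (hh : 0 < h) {y : Fin (k + 1) → ℂ}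
    (hy : gradC k h 0 *ᵥ y = 0) : polyOf k y = C ((polyOf k y).eval 1) := by
  refine eq_C_of_derivative_eq_zero (derivative_eq_zero_of_grad (k := k)
    (a := (polyOf k y).eval (-1) - (polyOf k y).eval 1) (natDegree_polyOf_le y) fun W hW => ?_)
  obtain ⟨w, rfl⟩ := exists_polyOf_eq hW
  have := gradC_inner hh 0 w y
  rw [hy, dotProduct_zero] at this
  simpa [gradForm, phase_zero] using this.symm

theorem polyOf_eq_C_of_divC {k : ℕ} {h : ℝ} (hh : 0 < h) {y : Fin (k + 1) → ℂ}
    (hy : divC k h 0 *ᵥ y = 0) : polyOf k y = C ((polyOf k y).eval 1) := by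
  refine eq_C_of_derivative_eq_zero (derivative_eq_zero_of_div (k := k)
    (b := (polyOf k y).eval (-1) - (polyOf k y).eval 1) (natDegree_polyOf_le y) fun W hW => ?_)
  obtain ⟨w, rfl⟩ := exists_polyOf_eq hW
  have := divC_inner hh 0 w y
  rw [hy, dotProduct_zero] at this
  simpa [divForm, phase_zero] using this.symm

theorem norm_sq_of_massSphere_const {k : ℕ} {h : ℝ} (hh : 0 < h) {y : Fin (k + 1) → ℂ}
    (hy : y ∈ massSphere k h) (hC : polyOf k y = C ((polyOf k y).eval 1)) :
    ‖(polyOf k y).eval 1‖ ^ 2 = 1 / h := by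
  rw [mem_massSphere_iff hh, hC, refNormSq_C] at hy
  rw [eq_div_iff hh.ne']
  linarith

theorem continuous_norm_sq_functional {k : ℕ} (f : ℂ[X] →ₗ[ℂ] ℂ) :
    Continuous fun y : Fin (k + 1) → ℂ => ‖f (polyOf k y)‖ ^ 2 := by
  have : Continuous (f ∘ₗ polyOf k) := LinearMap.continuous_of_finiteDimensional _
  exact this.norm.pow 2

/-- The test function 1 reduces the gradient equation to (h/2)∫Q = (1 - z)U(1). -/
theorem IsEigenpair.mul_norm_refInt_sq {k : ℕ} {h ξ s : ℝ} (hh : 0 < h) {u : Fin (k + 1) → ℂ}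
    (hu : IsEigenpair k h ξ s u) :
    h ^ 2 / 4 * ‖refInt (polyOf k (gradVec k h ξ u))‖ ^ 2
      = (2 * Real.sin (ξ * h / 2)) ^ 2 * ‖(polyOf k u).eval 1‖ ^ 2 := by
  have h1 := (hu.isModePair hh).grad 1 (by simp)
  rw [one_mul, mul_one, refInt_derivative, eval_one] at h1
  have h2 : (h / 2 : ℂ) * refInt (polyOf k (gradVec k h ξ u))
      = (1 - phase h ξ) * (polyOf k u).eval 1 := by linear_combination h1
  have h3 := congrArg (fun x => ‖x‖ ^ 2) h2
  simp only [norm_mul, mul_pow, norm_one_sub_phase_sq] at h3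
  rw [mul_pow, ← h3, norm_div, Complex.norm_real, Real.norm_of_nonneg hh.le]
  norm_num [div_pow]

theorem tendsto_sin_sq_div (h : ℝ) :
    Tendsto (fun ξ => (2 * Real.sin (ξ * h / 2)) ^ 2 / ξ ^ 2) (𝓝[≠] 0) (𝓝 (h ^ 2)) := by
  have h1 : HasDerivAt (fun ξ => 2 * Real.sin (ξ * h / 2))
      (2 * (Real.cos (0 * h / 2) * (1 * h / 2))) 0 :=
    ((((hasDerivAt_id' (0 : ℝ)).mul_const h).div_const 2).sin).const_mul 2
  have h2 := h1.tendsto_slope_zero.pow 2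
  simp only [zero_mul, zero_div, Real.cos_zero, one_mul, Real.sin_zero, mul_zero, sub_zero,
    zero_add, smul_eq_mul] at h2
  rw [mul_div_cancel₀ _ two_ne_zero] at h2
  refine h2.congr fun ξ => ?_
  rw [mul_pow, inv_pow, inv_mul_eq_div]

/-- The physical branch behaves like `ξ²` at the origin. -/
theorem IsModeFamily.tendsto_physical_div_sq {k : ℕ} {h : ℝ} {σ : Fin (k + 1) → ℝ → ℝ}
    {ph : Fin (k + 1)} (hσ : IsModeFamily k h σ ph) (hh : 0 < h) :
    Tendsto (fun ξ => σ ph ξ / ξ ^ 2) (𝓝[≠] 0) (𝓝 1) := by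
  have hl := IsLimitFilter.punctured hh
  choose! v hv ho using hσ.eigenbasis
  set u : ℝ → Fin (k + 1) → ℂ := fun ξ => v ξ ph with hu
  set r : ℝ → ℂ := fun ξ => (√(σ ph ξ) : ℂ) with hr
  -- By the energy identity, dividing the flux by √σ normalises it. The system becomes Gu = √σ Mq
  -- and Dq = -√σ Mu, with both right sides tending to 0.
  set q : ℝ → Fin (k + 1) → ℂ := fun ξ => (r ξ)⁻¹ • gradVec k h ξ (u ξ) with hq
  have hS : ∀ᶠ ξ in 𝓝[≠] (0 : ℝ), ξ ∈ freqDomain h :=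
    hl.mem_Ioo.mono fun _ hx => Set.Ioo_subset_Icc_self hx
  have hpos : ∀ᶠ ξ in 𝓝[≠] (0 : ℝ), 0 < σ ph ξ := by
    filter_upwards [hS, hl.ne_zero] with ξ hξ h0 using hσ.pos_of_ne_zero hh hξ h0 ph
  have hr0 : Tendsto r (𝓝[≠] 0) (𝓝 0) := by
    have h1 := hσ.tendsto hh ph hl
    rw [hσ.physical] at h1
    have h2 := (Complex.continuous_ofReal.tendsto _).comp h1.sqrt
    rwa [Real.sqrt_zero, Complex.ofReal_zero] at h2
  have hrsq : ∀ ξ, 0 < σ ph ξ → r ξ * r ξ = σ ph ξ := fun ξ h0 => by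
    rw [hr, ← Complex.ofReal_mul, Real.mul_self_sqrt h0.le]
  have hrne : ∀ ξ, 0 < σ ph ξ → r ξ ≠ 0 := fun ξ h0 => by
    rw [hr, Complex.ofReal_ne_zero]; exact (Real.sqrt_pos.mpr h0).ne'
  have hrn : ∀ ξ, 0 < σ ph ξ → ‖r ξ‖ ^ 2 = σ ph ξ := fun ξ h0 => by
    rw [hr, Complex.norm_real, Real.norm_of_nonneg (Real.sqrt_nonneg _), Real.sq_sqrt h0.le]
  have hgq : ∀ ξ, 0 < σ ph ξ → gradVec k h ξ (u ξ) = r ξ • q ξ := fun ξ h0 => by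
    rw [hq, smul_inv_smul₀ (hrne ξ h0)]
  have huS : ∀ᶠ ξ in 𝓝[≠] (0 : ℝ), u ξ ∈ massSphere k h := by
    filter_upwards [hS] with ξ hξ
    have := ho ξ hξ ph ph
    rwa [if_pos rfl] at this
  have hqS : ∀ᶠ ξ in 𝓝[≠] (0 : ℝ), q ξ ∈ massSphere k h := by
    filter_upwards [hS, huS, hpos] with ξ hξ hu1 h0
    have h1 := ((hv ξ hξ ph).isModePair hh).refNormSq_flux hh
    rw [mem_massSphere_iff hh] at hu1 ⊢
    have h2 : refNormSq (polyOf k (gradVec k h ξ (u ξ))) = σ ph ξ * refNormSq (polyOf k (q ξ)) := by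
      rw [hgq ξ h0, map_smul]
      simp only [refNormSq, eval_smul, norm_smul, mul_pow, hrn ξ h0]
      exact intervalIntegral.integral_const_mul _ _
    rw [h2] at h1
    rw [mul_left_cancel₀ h0.ne' h1]
    exact hu1
  have hphase := continuous_phase h
  have hGc : Continuous (gradC k h) := by
    unfold gradC; fun_prop
  have hDc : Continuous (divC k h) := by
    unfold divC
    exact continuous_const.add ((Complex.continuous_conj.comp hphase).smul continuous_const)
  have hG : Tendsto (fun ξ => gradC k h ξ *ᵥ u ξ) (𝓝[≠] 0) (𝓝 0) := by
    refine (tendsto_smul_massC hh hr0 hqS).congr' ?_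
    filter_upwards [hpos] with ξ h0
    rw [← mulVec_smul, ← hgq ξ h0, massC_mulVec_gradVec hh]
  have hD : Tendsto (fun ξ => divC k h ξ *ᵥ q ξ) (𝓝[≠] 0) (𝓝 0) := by
    have hr0' : Tendsto (fun ξ => -r ξ) (𝓝[≠] 0) (𝓝 0) := by simpa using hr0.neg
    refine (tendsto_smul_massC hh hr0' huS).congr' ?_
    filter_upwards [hpos, hS] with ξ h0 hξ
    rw [hq, mulVec_smul, divC_mulVec_gradVec (hv ξ hξ ph), smul_smul, ← hrsq ξ h0]
    congr 1
    field_simp [hrne ξ h0]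
  have hA : Tendsto (fun ξ => ‖leval (1 : ℂ) (polyOf k (u ξ))‖ ^ 2) (𝓝[≠] 0) (𝓝 (1 / h)) :=
    tendsto_of_asymptotic_kernel hh nhdsWithin_le_nhds hGc huS hG
      (f := fun y => ‖leval (1 : ℂ) (polyOf k y)‖ ^ 2) (continuous_norm_sq_functional _)
      fun y hy hy0 => norm_sq_of_massSphere_const hh hy (polyOf_eq_C_of_gradC hh hy0)
  have hB : Tendsto (fun ξ => ‖refInt (polyOf k (q ξ))‖ ^ 2) (𝓝[≠] 0) (𝓝 (4 / h)) := by
    refine tendsto_of_asymptotic_kernel hh nhdsWithin_le_nhds hDc hqS hD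
      (f := fun y => ‖refInt (polyOf k y)‖ ^ 2) (continuous_norm_sq_functional _) ?_
    intro y hy hy0
    have hC := polyOf_eq_C_of_divC hh hy0
    have h1 := norm_sq_of_massSphere_const hh hy hC
    rw [hC, refInt_C, norm_mul, mul_pow, h1]
    norm_num; ring
  -- The identity σ (h²/4)|∫q|² = 4 sin²(ξh/2)|U(1)|² is solved for σ/ξ².
  have hlim := ((tendsto_sin_sq_div h).mul hA).div (hB.const_mul (h ^ 2 / 4)) (by positivity)
  rw [show h ^ 2 * (1 / h) / (h ^ 2 / 4 * (4 / h)) = 1 by field_simp] at hlim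
  refine hlim.congr' ?_
  filter_upwards [hS, hpos, hl.ne_zero,
    hB.eventually_const_lt (by positivity : 0 < 4 / h)] with ξ hξ h0 hξ0 hBpos
  have h1 := (hv ξ hξ ph).mul_norm_refInt_sq hh
  have h2 : refInt (polyOf k (gradVec k h ξ (u ξ))) = r ξ * refInt (polyOf k (q ξ)) := by
    rw [hgq ξ h0, map_smul, map_smul, smul_eq_mul]
  rw [h2, norm_mul, mul_pow, hrn ξ h0] at h1
  simp only [Pi.div_apply, leval_apply]
  have hne := hBpos.ne'
  rw [div_mul_eq_mul_div, ← h1, div_div, mul_comm (ξ ^ 2), ← div_div, ← mul_assoc,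
    mul_right_comm, mul_div_assoc, mul_div_cancel₀ _ (by positivity)]

/-! ### The piecewise constant case -/

/-- For piecewise constants the only branch is `(2/h)² sin²(ξh/2)`. -/
theorem IsModeFamily.eq_of_degree_zero {h : ℝ} {σ : Fin (0 + 1) → ℝ → ℝ} {ph : Fin (0 + 1)}
    (hσ : IsModeFamily 0 h σ ph) (hh : 0 < h) {ξ : ℝ} (hξ : ξ ∈ freqDomain h) (j : Fin (0 + 1)) :
    σ j ξ = (2 * Real.sin (ξ * h / 2) / h) ^ 2 := by
  obtain ⟨v, hv, -⟩ := hσ.eigenbasis ξ hξ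
  have hp := (hv j).isModePair hh
  have hne := polyOf_ne_zero (hv j).1
  have h1 := (hv j).mul_norm_refInt_sq hh
  have h2 := hp.refNormSq_flux hh
  rw [eq_C_of_natDegree_le_zero hp.degU] at h1 h2 hne
  rw [eq_C_of_natDegree_le_zero hp.degQ] at h1 h2
  rw [refNormSq_C, refNormSq_C] at h2
  rw [refInt_C, eval_C, norm_mul, mul_pow] at h1
  have h3 : (0 : ℝ) < ‖(polyOf 0 (v j)).coeff 0‖ ^ 2 := by
    have := norm_pos_iff.mpr (C_ne_zero.mp hne); positivity
  norm_num at h1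
  rw [div_pow, eq_div_iff (by positivity)]
  refine mul_right_cancel₀ h3.ne' ?_
  linear_combination (-h ^ 2 / 2) * h2 + h1

/-- With piecewise constants and `Δt = h` the scheme is exact. -/
theorem IsModeFamily.temporalFreq_eq_of_degree_zero {h : ℝ} {σ : Fin (0 + 1) → ℝ → ℝ}
    {ph : Fin (0 + 1)} (hσ : IsModeFamily 0 h σ ph) (hh : 0 < h) {ξ : ℝ} (hξ : ξ ∈ freqDomain h)
    (j : Fin (0 + 1)) : temporalFreq h (σ j) ξ = ξ := by
  -- These bounds place ξh/2 where arcsin inverts sin.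
  have hl : -(Real.pi / 2) ≤ ξ * h / 2 := by
    have := mul_le_mul_of_nonneg_right hξ.1 hh.le
    rw [neg_mul, div_mul_cancel₀ _ hh.ne'] at this; linarith
  have hr : ξ * h / 2 ≤ Real.pi / 2 := by
    have := mul_le_mul_of_nonneg_right hξ.2 hh.le
    rw [div_mul_cancel₀ _ hh.ne'] at this; linarith
  have harg : ∀ x : ℝ, |2 * x / h| * h / 2 = |x| := fun x => by
    rw [abs_div, abs_mul, abs_of_pos hh, abs_two]; field_simp
  have hpi := Real.pi_pos
  rw [temporalFreq, hσ.eq_of_degree_zero hh hξ j, Real.sqrt_sq_eq_abs, harg]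
  rcases lt_trichotomy ξ 0 with hn | rfl | hp
  · have h1 : ξ * h / 2 < 0 := by have := mul_neg_of_neg_of_pos hn hh; linarith
    rw [abs_of_nonpos (Real.sin_nonpos_of_nonpos_of_neg_pi_le h1.le (by linarith)),
      ← Real.sin_neg, Real.arcsin_sin (by linarith) (by linarith), Real.sign_of_neg hn]
    field_simp
  · simp
  · have h1 : 0 < ξ * h / 2 := by positivity
    rw [abs_of_nonneg (Real.sin_nonneg_of_nonneg_of_le_pi h1.le (by linarith)),
      Real.arcsin_sin (by linarith) (by linarith), Real.sign_of_pos hp]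
    field_simp

/-! ### Limits of the group velocities -/

/-- The physical branch at the edge of the frequency domain. -/
theorem IsModeFamily.physical_groupVelocity_edge {k : ℕ} {h Δt : ℝ} {σ : Fin (k + 1) → ℝ → ℝ}
    {ph : Fin (k + 1)} (hσ : IsModeFamily k h σ ph) (hh : 0 < h) (hΔt : 0 < Δt)
    (hst : Stable k h Δt) {l : Filter ℝ} {ξ₀ : ℝ} (hl : IsLimitFilter h l ξ₀)
    (hξ₀ : ξ₀ = Real.pi / h ∨ ξ₀ = -(Real.pi / h)) :
    GroupVelocityTendsto (temporalFreq Δt (σ ph)) l (if k = 0 ∧ Δt = h then 1 else 0) := by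
  have hmem := hl.mem_freqDomain hh
  have hne : ξ₀ ≠ 0 := by
    rcases hξ₀ with rfl | rfl
    exacts [(pi_div_pos hh).ne', neg_ne_zero.mpr (pi_div_pos hh).ne']
  split_ifs with hc
  · obtain ⟨rfl, rfl⟩ := hc
    have hd : ∀ᶠ ξ in l, HasDerivAt (temporalFreq Δt (σ ph)) 1 ξ := by
      filter_upwards [hl.mem_Ioo] with ξ hξ
      refine (hasDerivAt_id' ξ).congr_of_eventuallyEq ?_
      filter_upwards [Ioo_mem_nhds hξ.1 hξ.2] with x hx
      exact hσ.temporalFreq_eq_of_degree_zero hh (Set.Ioo_subset_Icc_self hx) ph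
    refine ⟨hd.mono fun ξ h => h.differentiableAt, ?_⟩
    exact tendsto_const_nhds.congr' (hd.mono fun ξ h => h.deriv.symm)
  · refine groupVelocityTendsto_zero hΔt (hσ.tendsto hh ph hl)
      (hσ.pos_of_ne_zero hh hmem hne ph) ?_ hl.ne_zero
      (hl.mem_Ioo.mono fun ξ hξ => hσ.differentiableAt ph hξ) (hσ.tendsto_deriv hh ph hl)
    refine lt_of_le_of_ne (hσ.le_of_stable hst hmem ph) fun heq => hc ?_
    -- A second branch would lie strictly above the physical one and exceed the stability bound.
    have hk : k = 0 := by
      by_contra hk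
      have : Nontrivial (Fin (k + 1)) := Fin.nontrivial_iff_two_le.mpr (by omega)
      obtain ⟨j, hj⟩ := exists_ne ph
      have h1 := hσ.physical_lt hh hj hmem
      have h2 := hσ.le_of_stable hst hmem j
      linarith
    refine ⟨hk, ?_⟩
    subst hk
    rw [hσ.eq_of_degree_zero hh hmem] at heq
    have hsin : Real.sin (ξ₀ * h / 2) ^ 2 = 1 := by
      rcases hξ₀ with rfl | rfl
      · rw [div_mul_cancel₀ _ hh.ne', Real.sin_pi_div_two, one_pow]
      · rw [neg_mul, div_mul_cancel₀ _ hh.ne', neg_div, Real.sin_neg, Real.sin_pi_div_two]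
        norm_num
    rw [div_pow, mul_pow, hsin] at heq
    field_simp at heq
    have h1 : Δt ^ 2 = h ^ 2 := by linarith
    exact (pow_left_inj₀ hΔt.le hh.le two_ne_zero).mp h1

theorem IsModeFamily.physical_groupVelocity_zero {k : ℕ} {h Δt : ℝ} {σ : Fin (k + 1) → ℝ → ℝ}
    {ph : Fin (k + 1)} (hσ : IsModeFamily k h σ ph) (hh : 0 < h) (hΔt : 0 < Δt) :
    GroupVelocityTendsto (temporalFreq Δt (σ ph)) (𝓝[≠] 0) 1 := by
  have hmem := zero_mem_freqDomain hh
  have hnhds : freqDomain h ∈ 𝓝 (0 : ℝ) :=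
    Icc_mem_nhds (by linarith [pi_div_pos hh]) (pi_div_pos hh)
  have hl := IsLimitFilter.punctured hh
  refine groupVelocityTendsto_one hΔt ?_ hσ.physical ?_ ?_ (hσ.tendsto_physical_div_sq hh)
  · exact ((hσ.contDiffOn ph).contDiffAt hnhds).analyticAt
  · rw [← derivWithin_of_mem_nhds hnhds]
    exact hσ.derivWithin_eq_zero hh ph (Or.inl rfl) hmem
  · filter_upwards [hl.mem_Ioo, hl.ne_zero] with ξ hξ h0
    exact hσ.pos_of_ne_zero hh (Set.Ioo_subset_Icc_self hξ) h0 ph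

theorem IsModeFamily.spurious_groupVelocity {k : ℕ} {h Δt : ℝ} {σ : Fin (k + 1) → ℝ → ℝ}
    {ph : Fin (k + 1)} (hσ : IsModeFamily k h σ ph) (hh : 0 < h) (hΔt : 0 < Δt)
    (hst : Stable k h Δt) {i : Fin (k + 1)} (hi : i ≠ ph) {l : Filter ℝ} {ξ₀ : ℝ}
    (hl : IsLimitFilter h l ξ₀)
    (hnot : ¬ Tendsto (fun ξ => |temporalFreq Δt (σ i) ξ|) l (𝓝 (Real.pi / Δt))) :
    GroupVelocityTendsto (temporalFreq Δt (σ i)) l 0 := by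
  have hmem := hl.mem_freqDomain hh
  refine groupVelocityTendsto_zero hΔt (hσ.tendsto hh i hl) (hσ.pos_of_ne hh hmem hi) ?_
    hl.ne_zero (hl.mem_Ioo.mono fun ξ hξ => hσ.differentiableAt i hξ) (hσ.tendsto_deriv hh i hl)
  refine lt_of_le_of_ne (hσ.le_of_stable hst hmem i) fun heq => hnot ?_
  have := hσ.tendsto hh i hl
  rw [heq] at this
  exact tendsto_abs_temporalFreq hΔt this hl.ne_zero

end LDG

end

theorem theorem3p3 (k : ℕ) (h Δt : ℝ) (hh : 0 < h) (hΔt : 0 < Δt) (hstab : LDG.Stable k h Δt) :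
    -- analytic branches exist
    (∃ (σ : Fin (k + 1) → ℝ → ℝ) (ph : Fin (k + 1)), LDG.IsModeFamily k h σ ph) ∧
    ∀ (σ : Fin (k + 1) → ℝ → ℝ) (ph : Fin (k + 1)), LDG.IsModeFamily k h σ ph →
      -- physical mode
      (LDG.GroupVelocityTendsto (LDG.temporalFreq Δt (σ ph)) (𝓝[≠] 0) 1 ∧
        LDG.GroupVelocityTendsto (LDG.temporalFreq Δt (σ ph)) (𝓝[<] (Real.pi / h))
          (if k = 0 ∧ Δt = h then 1 else 0) ∧
        LDG.GroupVelocityTendsto (LDG.temporalFreq Δt (σ ph)) (𝓝[>] (-(Real.pi / h)))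
          (if k = 0 ∧ Δt = h then 1 else 0)) ∧
      -- spurious modes: at each of the four limits, unless `|ω|` tends to `π / Δt` there
      (∀ i, i ≠ ph → ∀ l : Filter ℝ,
        (l = 𝓝[>] 0 ∨ l = 𝓝[<] 0 ∨ l = 𝓝[<] (Real.pi / h) ∨ l = 𝓝[>] (-(Real.pi / h))) →
        ¬ Tendsto (fun ξ => |LDG.temporalFreq Δt (σ i) ξ|) l (𝓝 (Real.pi / Δt)) →
        LDG.GroupVelocityTendsto (LDG.temporalFreq Δt (σ i)) l 0) := by
  refine ⟨LDG.exists_modeFamily k hh, fun σ ph hσ =>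
    ⟨⟨hσ.physical_groupVelocity_zero hh hΔt, ?_, ?_⟩, fun i hi l hl hnot => ?_⟩⟩
  · exact hσ.physical_groupVelocity_edge hh hΔt hstab (LDG.IsLimitFilter.right hh) (Or.inl rfl)
  · exact hσ.physical_groupVelocity_edge hh hΔt hstab (LDG.IsLimitFilter.left hh) (Or.inr rfl)
  · obtain ⟨ξ₀, hl'⟩ := LDG.IsLimitFilter.of_mem hh hl
    exact hσ.spurious_groupVelocity hh hΔt hstab hi hl' hnot
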